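/- Let $G$ be a finite group and $r\ge 0$. The Dowling matroid $Q_r(G)$ is the matroid on the $r+\binom r2|G|$ elements $p_1,\dots,p_r$ and $a_{ij}$ (for $a\in G$ and $i\ne j$ in $\{1,\dots,r\}$, where $a_{ji}=(a^{-1})_{ij}$) in which a set $A$ has rank $r-b(A)$. Here $b(A)$ is the number of balanced components of $A$: consider the connected components of the graph on $\{1,\dots,r\}$ in which $i$ and $j$ are adjacent when some $a_{ij}$ is in $A$; a component $C$ is balanced if $p_i\notin A$ for all $i\in C$ and there is a function $\theta:C\to G$ with $\theta(i)\,a=\theta(j)$ whenever $i,j\in C$ and $a_{ij}\in A$. A cyclic flat of a matroid is a flat that is a union of circuits; the cyclic flats, ordered by inclusion, form a lattice. Two matroids without coloops have the same configuration if there is an isomorphism between their lattices of cyclic flats that preserves the size and the rank of each cyclic flat. The $\mathcal{G}$-invariant of a matroid $M$ on $n$ elements with rank function $\rho$ is the formal sum $\mathcal{G}(M)=\sum_\pi[\rho_1\rho_2\cdots\rho_n]$ over all $n!$ orderings $\pi$ of its elements, where $\rho_j=\rho(\{\pi(1),\dots,\pi(j)\})-\rho(\{\pi(1),\dots,\pi(j-1)\})$.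 (1) Let $r\ge 4$, and let $G$ and $\hat G$ be finite groups. If $Q_r(G)$ and $Q_r(\hat G)$ have the same configuration, then $G\cong\hat G$. (2) For every $r$, the invariant $\mathcal{G}(Q_r(G))$ depends only on $r$ and $|G|$: if $G$ and $\hat G$ are finite groups with $|G|=|\hat G|$, then $\mathcal{G}(Q_r(G))=\mathcal{G}(Q_r(\hat G))$. (3) Consequently, the $\mathcal{G}$-invariant of a matroid without coloops does not determine its configuration: for every $r\ge 4$ there are finite groups $G$ and $\hat G$ such that $Q_r(G)$ and $Q_r(\hat G)$ have no coloops and have the same $\mathcal{G}$-invariant, but do not have the same configuration. -/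

import Mathlib

/-! ## Dowling matroids -/

/-- The ground set of the rank-`r` Dowling matroid over the group `G`: the joints
`p_i` and the elements `a_{ij}` with `a ∈ G` and `i ≠ j`, where `a_{ji} = (a⁻¹)_{ij}`.
Every `a_{ij}` is written in exactly one way with `i < j`, so the elements are listed that way. -/
inductive DowlingElement (r : ℕ) (G : Type*) where
  | joint (i : Fin r) : DowlingElement r G
  | edge (i j : Fin r) (hij : i < j) (a : G) : DowlingElement r G

namespace DowlingElement

instance instFinite (r : ℕ) (G : Type*) [Finite G] : Finite (DowlingElement r G) := by
  refine Finite.of_injective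
    (β := Fin r ⊕ (Fin r × Fin r × G))
    (fun e => match e with
      | joint i => Sum.inl i
      | edge i j _ a => Sum.inr (i, j, a)) ?_
  rintro (i | ⟨i, j, h, a⟩) (i' | ⟨i', j', h', a'⟩) hh <;> simp_all

end DowlingElement

namespace Dowling

open DowlingElement

variable {r : ℕ} {G : Type*}

/-- The graph on the index set `{1, …, r}` in which `i` and `j` are adjacent when some `a_{ij}`
belongs to `A`. -/
def graph (A : Set (DowlingElement r G)) : SimpleGraph (Fin r) :=
  SimpleGraph.fromRel fun i j => ∃ (hij : i < j) (a : G), edge i j hij a ∈ A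

theorem mk_eq_of_edge {A : Set (DowlingElement r G)} {i j : Fin r} {hij : i < j} {a : G}
    (h : edge i j hij a ∈ A) :
    (graph A).connectedComponentMk i = (graph A).connectedComponentMk j := by
  apply SimpleGraph.ConnectedComponent.sound
  apply SimpleGraph.Adj.reachable
  rw [graph, SimpleGraph.fromRel_adj]
  exact ⟨hij.ne, Or.inl ⟨hij, a, h⟩⟩

theorem eq_of_mk_eq {A : Set (DowlingElement r G)} {X : Sort*} (f : Fin r → X)
    (hf : ∀ (i j : Fin r) (hij : i < j) (a : G), edge i j hij a ∈ A → f i = f j) {i j : Fin r}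
    (h : (graph A).connectedComponentMk i = (graph A).connectedComponentMk j) : f i = f j := by
  obtain ⟨w⟩ := SimpleGraph.ConnectedComponent.exact h
  clear h
  induction w with
  | nil => rfl
  | cons hadj _ ih =>
    rw [← ih]
    rw [graph, SimpleGraph.fromRel_adj] at hadj
    obtain ⟨_, ⟨hij, a, ha⟩ | ⟨hij, a, ha⟩⟩ := hadj
    · exact hf _ _ hij a ha
    · exact (hf _ _ hij a ha).symm

variable [Group G]

/-- A connected component `c` of the graph of `A` is balanced if no joint `p_i` with `i ∈ c` is
in `A`, and the gains of the edges of `A` in `c` come from a potential `θ`: if `a_{ij} ∈ A` then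
`a = θ(i)⁻¹ θ(j)`. (Equivalently, the product of the gains around each cycle in `c` is `1`.) -/
def IsBalanced (A : Set (DowlingElement r G)) (c : (graph A).ConnectedComponent) : Prop :=
  (∀ i : Fin r, i ∈ c.supp → joint i ∉ A) ∧
    ∃ θ : Fin r → G, ∀ (i j : Fin r) (hij : i < j) (a : G), i ∈ c.supp →
      edge i j hij a ∈ A → θ i * a = θ j

/-- The number `b(A)` of balanced components of `A`. Isolated vertices count as components. -/
noncomputable def numBalanced (A : Set (DowlingElement r G)) : ℕ :=
  Nat.card {c : (graph A).ConnectedComponent // IsBalanced A c}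

/-! ### The matroid axioms

A solution of `A` is a labelling of the indices by elements of `G ∪ {0}` that is compatible with
the elements of `A`; there are `(|G| + 1) ^ b(A)` of them. -/

/-- Labellings `x` with `x i = 0` for `p_i ∈ A` and `x i * a = x j` for `a_{ij} ∈ A`. -/
def solutions (A : Set (DowlingElement r G)) : Set (Fin r → WithZero G) :=
  {x | (∀ i, joint i ∈ A → x i = 0) ∧
    ∀ (i j : Fin r) (hij : i < j) (a : G), edge i j hij a ∈ A → x i * (a : WithZero G) = x j}

theorem solutions_anti {A B : Set (DowlingElement r G)} (h : A ⊆ B) :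
    solutions B ⊆ solutions A :=
  fun _ hx => ⟨fun i hi => hx.1 i (h hi), fun i j hij a ha => hx.2 i j hij a (h ha)⟩

theorem mul_coe_eq_zero_iff (x : WithZero G) (a : G) : x * (a : WithZero G) = 0 ↔ x = 0 := by
  simp

theorem solutions_eq_of_mk_eq {A : Set (DowlingElement r G)} {x y : Fin r → WithZero G}
    (hx : x ∈ solutions A) (hy : y ∈ solutions A) {i j : Fin r}
    (h : (graph A).connectedComponentMk i = (graph A).connectedComponentMk j)
    (hi : x i = y i) : x j = y j := by
  refine (eq_of_mk_eq (A := A) (fun k => x k = y k) ?_ h).mp hi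
  intro k l hkl a ha
  have h1 := hx.2 k l hkl a ha
  have h2 := hy.2 k l hkl a ha
  refine propext ⟨fun h => by rw [← h1, ← h2, h], fun h => ?_⟩
  have : x k * (a : WithZero G) = y k * (a : WithZero G) := by rw [h1, h2, h]
  exact mul_right_cancel₀ (WithZero.coe_ne_zero) this

theorem solutions_zero_iff {A : Set (DowlingElement r G)} {x : Fin r → WithZero G}
    (hx : x ∈ solutions A) {i j : Fin r}
    (h : (graph A).connectedComponentMk i = (graph A).connectedComponentMk j) :
    x i = 0 ↔ x j = 0 := by
  refine Iff.of_eq (eq_of_mk_eq (A := A) (fun k => x k = 0) ?_ h)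
  intro k l hkl a ha
  rw [← hx.2 k l hkl a ha, mul_coe_eq_zero_iff]

open Classical in
theorem replace_mem {A : Set (DowlingElement r G)} {x u : Fin r → WithZero G}
    (hx : x ∈ solutions A) (hu : u ∈ solutions A) (t : WithZero G)
    (c : (graph A).ConnectedComponent) :
    (fun k => if (graph A).connectedComponentMk k = c then t * u k else x k) ∈ solutions A := by
  refine ⟨fun i hi => ?_, fun i j hij a ha => ?_⟩
  · simp [hx.1 i hi, hu.1 i hi]
  · have := mk_eq_of_edge ha
    simp only [this, ← hx.2 i j hij a ha, ← hu.2 i j hij a ha]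
    split_ifs
    · rw [mul_assoc]
    · rfl

open Classical in
theorem card_solutions [Finite G] (A : Set (DowlingElement r G)) :
    Nat.card (solutions A) = (Nat.card G + 1) ^ numBalanced A := by
  have hθ : ∀ c : {c : (graph A).ConnectedComponent // IsBalanced A c},
      ∃ θ : Fin r → G, ∀ (i j : Fin r) (hij : i < j) (a : G), i ∈ c.1.supp →
      edge i j hij a ∈ A → θ i * a = θ j := fun c => c.2.2
  choose θ hθ using hθ
  let Φ : ({c : (graph A).ConnectedComponent // IsBalanced A c} → WithZero G) →
      (Fin r → WithZero G) := fun f i =>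
    if h : IsBalanced A ((graph A).connectedComponentMk i) then
      f ⟨_, h⟩ * (θ ⟨_, h⟩ i : WithZero G) else 0
  have hΦ : ∀ f (c : {c : (graph A).ConnectedComponent // IsBalanced A c}) i,
      (graph A).connectedComponentMk i = c.1 → Φ f i = f c * (θ c i : WithZero G) := by
    rintro f ⟨c, hc⟩ i rfl
    simp only [Φ, hc, dite_true]
  have hΦ0 : ∀ f i, ¬ IsBalanced A ((graph A).connectedComponentMk i) → Φ f i = 0 := by
    intro f i hi
    simp only [Φ, hi, dite_false]
  have hinj : Function.Injective Φ := by
    intro f g hfg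
    funext c
    obtain ⟨i, hi⟩ := c.1.exists_rep
    have := congrFun hfg i
    rw [hΦ f c i hi, hΦ g c i hi] at this
    exact mul_right_cancel₀ WithZero.coe_ne_zero this
  have hrange : Set.range Φ = solutions A := by
    ext x
    constructor
    · rintro ⟨f, rfl⟩
      refine ⟨fun i hi => hΦ0 f i fun hb => hb.1 i rfl hi, fun i j hij a ha => ?_⟩
      have hm := mk_eq_of_edge ha
      by_cases hb : IsBalanced A ((graph A).connectedComponentMk i)
      · rw [hΦ f ⟨_, hb⟩ i rfl, hΦ f ⟨_, hb⟩ j hm.symm, mul_assoc, ← WithZero.coe_mul,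
          hθ ⟨_, hb⟩ i j hij a rfl ha]
      · rw [hΦ0 f i hb, hΦ0 f j (hm ▸ hb), zero_mul]
    · intro hx
      choose ρ hρ using fun c : {c : (graph A).ConnectedComponent // IsBalanced A c} =>
        c.1.exists_rep
      obtain ⟨f, hf⟩ : ∃ f : {c : (graph A).ConnectedComponent // IsBalanced A c} → WithZero G,
          ∀ c, f c = x (ρ c) * (θ c (ρ c) : WithZero G)⁻¹ := ⟨_, fun _ => rfl⟩
      refine ⟨f, ?_⟩
      funext i
      by_cases hb : IsBalanced A ((graph A).connectedComponentMk i)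
      · set c : {c : (graph A).ConnectedComponent // IsBalanced A c} := ⟨_, hb⟩ with hc
        rw [hΦ f c i rfl, hf]
        have hout : (graph A).connectedComponentMk (ρ c) = c.1 := hρ c
        have hsol : (fun k => if (graph A).connectedComponentMk k = c.1 then
            (x (ρ c) * (θ c (ρ c) : WithZero G)⁻¹) * (θ c k : WithZero G) else x k)
            ∈ solutions A := by
          refine ⟨fun k hk => ?_, fun k l hkl a ha => ?_⟩
          · have : ¬ (graph A).connectedComponentMk k = c.1 := fun h => hb.1 k h hk
            simp only [this, if_false, hx.1 k hk]
          · have hm := mk_eq_of_edge ha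
            by_cases hk : (graph A).connectedComponentMk k = c.1
            · simp only [hk, ← hm, if_true]
              rw [mul_assoc, ← WithZero.coe_mul, hθ c k l hkl a hk ha]
            · simp only [hk, ← hm, if_false, hx.2 k l hkl a ha]
        have key := solutions_eq_of_mk_eq hsol hx (i := ρ c) (j := i) (by rw [hout]) (by
          simp only [hout, if_true]
          exact inv_mul_cancel_right₀ WithZero.coe_ne_zero _)
        simpa [hc] using key
      · rw [hΦ0 f i hb]; symm
        by_contra h0
        apply hb
        have hne : ∀ k, (graph A).connectedComponentMk k = (graph A).connectedComponentMk i →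
            x k ≠ 0 := fun k hk h => h0 ((solutions_zero_iff hx hk).1 h)
        refine ⟨fun k hk hkA => hne k hk (hx.1 k hkA),
          fun k => if h : x k = 0 then 1 else WithZero.unzero h, ?_⟩
        intro k l hkl a hk ha
        have hk' := hne k hk
        have hl' := hne l ((mk_eq_of_edge ha).symm.trans hk)
        simp only [hk', hl', dite_false]
        apply WithZero.coe_injective
        simpa using hx.2 k l hkl a ha
  rw [← hrange, ← Nat.card_congr (Equiv.ofInjective Φ hinj), Nat.card_fun, numBalanced]
  congr 1
  exact Finite.card_option

theorem numBalanced_empty [Finite G] : numBalanced (∅ : Set (DowlingElement r G)) = r := by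
  have h := card_solutions (∅ : Set (DowlingElement r G))
  have h1 : solutions (∅ : Set (DowlingElement r G)) = Set.univ := by
    ext x; simp [solutions]
  have h2 : Nat.card (WithZero G) = Nat.card G + 1 := Finite.card_option
  rw [h1, Nat.card_coe_set_eq, Set.ncard_univ, Nat.card_fun, h2, Nat.card_fin] at h
  have : 0 < Nat.card G := Nat.card_pos
  exact (Nat.pow_right_injective (by omega) h).symm

instance finite_solutions [Finite G] (A : Set (DowlingElement r G)) : Finite (solutions A) := by
  have : Finite (WithZero G) := inferInstanceAs (Finite (Option G))
  infer_instance

theorem numBalanced_anti [Finite G] {A B : Set (DowlingElement r G)} (h : A ⊆ B) :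
    numBalanced B ≤ numBalanced A := by
  have hG : 0 < Nat.card G := Nat.card_pos
  have hc : Nat.card (solutions B) ≤ Nat.card (solutions A) :=
    Nat.card_mono (Set.toFinite _) (solutions_anti h)
  rw [card_solutions, card_solutions] at hc
  exact (Nat.pow_le_pow_iff_right (by omega)).1 hc

theorem solutions_eq_of_numBalanced [Finite G] {A B : Set (DowlingElement r G)} (h : A ⊆ B)
    (hb : numBalanced A = numBalanced B) : solutions B = solutions A := by
  apply Set.eq_of_subset_of_ncard_le (solutions_anti h) _ (Set.toFinite _)
  rw [← Nat.card_coe_set_eq, ← Nat.card_coe_set_eq, card_solutions, card_solutions, hb]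

open Classical in
/-- The injection that bounds the effect of one more element: overwrite the labels on one
component, and remember the old label at one of its vertices. -/
theorem numBalanced_le_of_replace [Finite G] {A B : Set (DowlingElement r G)} (i : Fin r)
    (u : Fin r → WithZero G) (t : (Fin r → WithZero G) → WithZero G)
    (h : ∀ x ∈ solutions A, (fun k => if (graph A).connectedComponentMk k =
      (graph A).connectedComponentMk i then t x * u k else x k) ∈ solutions B) :
    numBalanced A ≤ numBalanced B + 1 := by
  have : Finite (WithZero G) := inferInstanceAs (Finite (Option G))
  have hG : 0 < Nat.card G := Nat.card_pos
  have h2 : Nat.card (WithZero G) = Nat.card G + 1 := Finite.card_option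
  have hle : Nat.card (solutions A) ≤ Nat.card (solutions B × WithZero G) := by
    refine Nat.card_le_card_of_injective
      (fun x : solutions A => ((⟨_, h x.1 x.2⟩ : solutions B), x.1 i)) ?_
    rintro ⟨x, hx⟩ ⟨y, hy⟩ hxy
    simp only [Prod.mk.injEq, Subtype.mk.injEq] at hxy
    obtain ⟨h1, h3⟩ := hxy
    apply Subtype.ext
    funext k
    by_cases hk : (graph A).connectedComponentMk k = (graph A).connectedComponentMk i
    · exact solutions_eq_of_mk_eq hx hy hk.symm h3
    · simpa [hk] using congrFun h1 k
  rw [Nat.card_prod, card_solutions, card_solutions, h2, ← pow_succ] at hle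
  exact (Nat.pow_le_pow_iff_right (by omega)).1 hle

theorem mem_solutions_insert_joint {A : Set (DowlingElement r G)} {x : Fin r → WithZero G}
    {i : Fin r} (hx : x ∈ solutions A) (h : x i = 0) : x ∈ solutions (insert (joint i) A) := by
  refine ⟨fun k hk => ?_, fun k l hkl b hb => ?_⟩
  · rcases hk with hk | hk
    · cases hk; exact h
    · exact hx.1 k hk
  · rcases hb with hb | hb
    · cases hb
    · exact hx.2 k l hkl b hb

theorem mem_solutions_insert_edge {A : Set (DowlingElement r G)} {x : Fin r → WithZero G}
    {i j : Fin r} {hij : i < j} {a : G} (hx : x ∈ solutions A)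
    (h : x i * (a : WithZero G) = x j) : x ∈ solutions (insert (edge i j hij a) A) := by
  refine ⟨fun k hk => ?_, fun k l hkl b hb => ?_⟩
  · rcases hk with hk | hk
    · cases hk
    · exact hx.1 k hk
  · rcases hb with hb | hb
    · cases hb; exact h
    · exact hx.2 k l hkl b hb

open Classical in
theorem numBalanced_le_insert [Finite G] (A : Set (DowlingElement r G))
    (e : DowlingElement r G) : numBalanced A ≤ numBalanced (insert e A) + 1 := by
  have h0 : (0 : Fin r → WithZero G) ∈ solutions A := ⟨fun _ _ => rfl, fun _ _ _ _ _ => by simp⟩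
  cases e with
  | joint i =>
    refine numBalanced_le_of_replace i 0 (fun _ => 0) fun x hx => ?_
    exact mem_solutions_insert_joint (replace_mem hx h0 0 _) (by simp)
  | edge i j hij a =>
    by_cases hm : (graph A).connectedComponentMk i = (graph A).connectedComponentMk j
    · refine numBalanced_le_of_replace i 0 (fun _ => 0) fun x hx => ?_
      exact mem_solutions_insert_edge (replace_mem hx h0 0 _) (by simp [hm])
    · by_cases hu : ∃ u ∈ solutions A, u i ≠ 0
      · obtain ⟨u, hu, hui⟩ := hu
        refine numBalanced_le_of_replace i u
          (fun x => x j * (a : WithZero G)⁻¹ * (u i)⁻¹) fun x hx => ?_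
        refine mem_solutions_insert_edge (replace_mem hx hu _ _) ?_
        simp only [if_true, Ne.symm hm, if_false]
        rw [inv_mul_cancel_right₀ hui, inv_mul_cancel_right₀ WithZero.coe_ne_zero]
      · push Not at hu
        refine numBalanced_le_of_replace j 0 (fun _ => 0) fun x hx => ?_
        exact mem_solutions_insert_edge (replace_mem hx h0 0 _) (by simp [hm, hu x hx])

theorem numBalanced_le_add [Finite G] {A B : Set (DowlingElement r G)} (h : A ⊆ B) :
    A.ncard + numBalanced A ≤ B.ncard + numBalanced B := by
  have key : ∀ C : Set (DowlingElement r G), C.Finite →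
      A.ncard + numBalanced A ≤ (A ∪ C).ncard + numBalanced (A ∪ C) := by
    intro C hC
    induction C, hC using Set.Finite.induction_on with
    | empty => simp
    | @insert e C _ _ ih =>
      rw [Set.union_insert]
      by_cases he : e ∈ A ∪ C
      · rwa [Set.insert_eq_of_mem he]
      · rw [Set.ncard_insert_of_notMem he (Set.toFinite _)]
        have := numBalanced_le_insert (A ∪ C) e
        omega
  have := key B (Set.toFinite _)
  rwa [Set.union_eq_self_of_subset_left h] at this

theorem exists_aug [Finite G] {I J : Set (DowlingElement r G)}
    (hI : I.ncard + numBalanced I = r) (hJ : J.ncard + numBalanced J = r)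
    (hlt : I.ncard < J.ncard) :
    ∃ e ∈ J, e ∉ I ∧ (insert e I).ncard + numBalanced (insert e I) = r := by
  by_contra! hcon
  have hsame : ∀ e ∈ J, solutions (insert e I) = solutions I := by
    intro e he
    by_cases heI : e ∈ I
    · rw [Set.insert_eq_of_mem heI]
    · apply solutions_eq_of_numBalanced (Set.subset_insert _ _)
      have h1 := hcon e he heI
      rw [Set.ncard_insert_of_notMem heI (Set.toFinite _)] at h1
      have h2 := numBalanced_le_insert I e
      have h3 := numBalanced_anti (Set.subset_insert e I)
      omega
  have hsub : solutions I ⊆ solutions J := by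
    intro x hx
    refine ⟨fun i hi => ?_, fun i j hij a ha => ?_⟩
    · exact ((hsame _ hi).symm ▸ hx : x ∈ solutions (insert (joint i) I)).1 i
        (Set.mem_insert _ _)
    · exact ((hsame _ ha).symm ▸ hx : x ∈ solutions (insert (edge i j hij a) I)).2 i j hij a
        (Set.mem_insert _ _)
  have hc : Nat.card (solutions I) ≤ Nat.card (solutions J) :=
    Nat.card_mono (Set.toFinite _) hsub
  rw [card_solutions, card_solutions] at hc
  have hG : 0 < Nat.card G := Nat.card_pos
  have := (Nat.pow_le_pow_iff_right (by omega)).1 hc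
  omega

end Dowling

/-- The rank-`r` Dowling matroid `Q_r(G)`, in which a set `A` of elements has rank
`r - b(A)`, where `b(A)` is the number of balanced components of `A`. That is, `I` is independent
if and only if `|I| = r - b(I)`. -/
def dowlingMatroid (r : ℕ) (G : Type*) [Group G] [Finite G] : Matroid (DowlingElement r G) :=
  (IndepMatroid.ofFinite (E := Set.univ) Set.finite_univ
    (fun I => I.ncard + Dowling.numBalanced I = r)
    (by simpa using Dowling.numBalanced_empty)
    (fun I J hJ hIJ => by
      have h1 := Dowling.numBalanced_le_add hIJ
      have h2 := Dowling.numBalanced_le_add (Set.empty_subset I)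
      rw [Set.ncard_empty, Dowling.numBalanced_empty] at h2
      omega)
    (fun _ _ hI hJ hlt => Dowling.exists_aug hI hJ hlt)
    (fun _ _ => Set.subset_univ _)).matroid

/-! ## Configurations -/

namespace Matroid

/-- A set is cyclic if it is a union of circuits. -/
def IsCyclicSet {α : Type*} (M : Matroid α) (X : Set α) : Prop :=
  ∃ S : Set (Set α), (∀ C ∈ S, M.IsCircuit C) ∧ X = ⋃₀ S

/-- The collection `Z(M)` of cyclic flats of `M`, which is ordered by inclusion. -/
abbrev CyclicFlat {α : Type*} (M : Matroid α) : Type _ :=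
  {X : Set α // M.IsFlat X ∧ M.IsCyclicSet X}

/-- Two matroids have the same configuration if there is an isomorphism between their lattices
of cyclic flats that preserves the size and the rank of each cyclic flat. (An order isomorphism
between lattices is a lattice isomorphism.) -/
def SameConfiguration {α β : Type*} (M : Matroid α) (N : Matroid β) : Prop :=
  ∃ φ : M.CyclicFlat ≃o N.CyclicFlat, ∀ X : M.CyclicFlat,
    (φ X : Set β).encard = (X : Set α).encard ∧ N.eRk (φ X) = M.eRk X

/-! ## The `G`-invariant -/

/-- The rank sequence of an ordering `π` of the ground set of `M`: its `j`-th entry is the rank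
of the first `j` elements minus the rank of the first `j - 1` elements. -/
noncomputable def rankSequence {α : Type*} (M : Matroid α) {n : ℕ} (π : Fin n ≃ M.E) : List ℕ :=
  List.ofFn fun j : Fin n =>
    (M.eRk ((fun k => (π k : α)) '' Set.Iic j)).toNat -
      (M.eRk ((fun k => (π k : α)) '' Set.Iio j)).toNat

/-- The `G`-invariant of a finite matroid on `n` elements: the formal linear combination
`∑ π, [r(π)]` of rank sequences, where `π` ranges over all `n!` orderings of the ground set. -/
noncomputable def gInvariant {α : Type*} (M : Matroid α) : List ℕ →₀ ℚ :=
  ∑ᶠ π : Fin M.E.ncard ≃ M.E, Finsupp.single (M.rankSequence π) 1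

end Matroid

/-! Everything is read off from the solutions of a set `A`, the labellings of the indices by `G ∪
{0}` compatible with `A`. There are `(|G| + 1) ^ b(A)` of them, so ranks are counts of solutions,
and an element lies in the closure of `A` exactly when every solution of `A` respects it
(`mem_closure_iff`).

For the `G`-invariant, keep only the supports of the solutions. When an element is added, the new
supports depend on the old ones and the element alone, and they change exactly when the rank grows.
For an edge on `i, j` there are two cases. Either every gain has the same effect, or exactly one
gain changes nothing and all others discard the supports containing `i`. Only the number of gains
matters, so for groups of equal order the one-element extensions of two sets with equal supports can
be matched. Induction on the length matches all orderings together with their rank sequences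
(`exists_equiv_rankSteps`).

For the configuration, a nonempty cyclic flat of rank `n` with `1 ≤ n ≤ 3` is either full on `n`
indices or a block, given by a potential `θ` on `n + 1` indices (`eq_full_or_eq_block`). Unless the
group is trivial, size separates the two types in ranks two and three, and the size of a full flat
of rank three gives `|G|`. Fix four indices. An isomorphism sends blocks on them to blocks on four
indices, and their four triangles (the blocks on three of the indices) to triangles, because a
triangle is confined by the full flat on its index set. Hence the induced map `θ ↦ Ψ θ` preserves
and reflects agreement on each triangle. Two triangles share an edge, so `Ψ` acts on the gain of
each single edge. Composing gains around a triangle yields `γ (a * b) = α a * β b`, an isotopism,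
and isotopic groups are isomorphic.

For the last claim, take the cyclic group and the Klein group of order four. -/

/-! ## Rank, closure and cyclic sets in Dowling matroids -/

namespace Dowling

open DowlingElement

universe u

variable {r : ℕ} {G : Type u} [Group G]

/-- The labelling `x` is compatible with the element `e`. -/
def Compatible (x : Fin r → WithZero G) : DowlingElement r G → Prop
  | joint i => x i = 0
  | edge i j _ a => x i * (a : WithZero G) = x j

theorem mem_solutions_iff {A : Set (DowlingElement r G)} {x : Fin r → WithZero G} :
    x ∈ solutions A ↔ ∀ e ∈ A, Compatible x e := by
  constructor
  · rintro ⟨h1, h2⟩ (i | ⟨i, j, hij, a⟩) he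
    · exact h1 i he
    · exact h2 i j hij a he
  · exact fun h => ⟨fun i hi => h _ hi, fun i j hij a ha => h _ ha⟩

theorem mem_solutions_insert_iff {A : Set (DowlingElement r G)} {x : Fin r → WithZero G}
    {e : DowlingElement r G} :
    x ∈ solutions (insert e A) ↔ Compatible x e ∧ x ∈ solutions A := by
  simp only [mem_solutions_iff, Set.forall_mem_insert]

theorem zero_mem_solutions (A : Set (DowlingElement r G)) :
    (0 : Fin r → WithZero G) ∈ solutions A :=
  ⟨fun _ _ => rfl, fun _ _ _ _ _ => by simp⟩

instance finite_withZero [Finite G] : Finite (WithZero G) := inferInstanceAs (Finite (Option G))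

theorem card_withZero {G : Type*} [Finite G] : Nat.card (WithZero G) = Nat.card G + 1 :=
  Finite.card_option

theorem solutions_insert_eq_iff {A : Set (DowlingElement r G)} {e : DowlingElement r G} :
    solutions (insert e A) = solutions A ↔ ∀ x ∈ solutions A, Compatible x e := by
  constructor
  · intro h x hx
    rw [← h] at hx
    exact (mem_solutions_insert_iff.1 hx).1
  · intro h
    ext x
    rw [mem_solutions_insert_iff]
    exact ⟨And.right, fun hx => ⟨h x hx, hx⟩⟩

variable [Finite G]

theorem one_lt_card_withZero : 1 < Nat.card G + 1 := by
  have : 0 < Nat.card G := Nat.card_pos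
  omega

theorem numBalanced_eq_iff_solutions_eq {A B : Set (DowlingElement r G)} (h : A ⊆ B) :
    numBalanced A = numBalanced B ↔ solutions B = solutions A := by
  refine ⟨solutions_eq_of_numBalanced h, fun hs => ?_⟩
  have h1 := card_solutions A
  rw [← hs, card_solutions B] at h1
  exact (Nat.pow_right_injective one_lt_card_withZero h1).symm

@[simp]
theorem dowlingMatroid_E : (dowlingMatroid r G).E = Set.univ := rfl

theorem dowlingMatroid_indep_iff {I : Set (DowlingElement r G)} :
    (dowlingMatroid r G).Indep I ↔ I.ncard + numBalanced I = r := by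
  simp [dowlingMatroid]

/-- A new element lowers `numBalanced` by at most one, and the insertion is dependent exactly when
it lowers it by zero, that is, when no solution is lost. -/
theorem not_indep_insert_iff {I : Set (DowlingElement r G)} {e : DowlingElement r G}
    (hI : (dowlingMatroid r G).Indep I) (he : e ∉ I) :
    ¬ (dowlingMatroid r G).Indep (insert e I) ↔ ∀ x ∈ solutions I, Compatible x e := by
  rw [← solutions_insert_eq_iff, ← numBalanced_eq_iff_solutions_eq (Set.subset_insert _ _)]
  rw [dowlingMatroid_indep_iff] at hI ⊢
  rw [Set.ncard_insert_of_notMem he (Set.toFinite _)]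
  have h2 := numBalanced_le_insert I e
  have h3 := numBalanced_anti (Set.subset_insert e I)
  omega

theorem solutions_eq_of_isBasis {A I : Set (DowlingElement r G)}
    (hI : (dowlingMatroid r G).IsBasis I A) : solutions I = solutions A := by
  refine (solutions_anti hI.subset).antisymm' fun x hx => mem_solutions_iff.2 fun e he => ?_
  by_cases heI : e ∈ I
  · exact mem_solutions_iff.1 hx e heI
  · exact (not_indep_insert_iff hI.indep heI).1 (hI.insert_dep ⟨he, heI⟩).not_indep x hx

theorem eRk_dowlingMatroid (A : Set (DowlingElement r G)) :
    (dowlingMatroid r G).eRk A = (r - numBalanced A : ℕ) := by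
  obtain ⟨I, hI⟩ := (dowlingMatroid r G).exists_isBasis A (Set.subset_univ _)
  have h1 := dowlingMatroid_indep_iff.1 hI.indep
  rw [hI.eRk_eq_encard, ← (Set.toFinite I).cast_ncard_eq,
    ← (numBalanced_eq_iff_solutions_eq hI.subset).2 (solutions_eq_of_isBasis hI).symm]
  congr 1
  omega

/-- A basis of `A` has the same solutions as `A`, so the question reduces to an independent set,
where `not_indep_insert_iff` answers it. -/
theorem mem_closure_iff {A : Set (DowlingElement r G)} {e : DowlingElement r G} :
    e ∈ (dowlingMatroid r G).closure A ↔ ∀ x ∈ solutions A, Compatible x e := by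
  obtain ⟨I, hI⟩ := (dowlingMatroid r G).exists_isBasis A (Set.subset_univ _)
  rw [← hI.closure_eq_closure, ← solutions_eq_of_isBasis hI]
  by_cases heI : e ∈ I
  · exact ⟨fun _ x hx => mem_solutions_iff.1 hx e heI,
      fun _ => (dowlingMatroid r G).subset_closure I (Set.subset_univ _) heI⟩
  · rw [hI.indep.mem_closure_iff_of_notMem heI, ← not_indep_insert_iff hI.indep heI,
      Matroid.not_indep_iff (Set.subset_univ _)]

theorem isFlat_iff {A : Set (DowlingElement r G)} :
    (dowlingMatroid r G).IsFlat A ↔ ∀ e, (∀ x ∈ solutions A, Compatible x e) → e ∈ A := by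
  rw [Matroid.isFlat_iff_closure_eq]
  constructor
  · intro h e he
    rw [← h]
    exact mem_closure_iff.2 he
  · intro h
    exact Set.Subset.antisymm (fun e he => h e (mem_closure_iff.1 he))
      ((dowlingMatroid r G).subset_closure A (Set.subset_univ _))

theorem coloops_eq_empty_iff : (dowlingMatroid r G).coloops = ∅ ↔
    ∀ e, ∀ x ∈ solutions {e}ᶜ, Compatible (G := G) (r := r) x e := by
  simp only [← mem_closure_iff, Set.eq_empty_iff_forall_notMem,
    ← Matroid.isColoop_iff_mem_coloops]
  refine forall_congr' fun e => ?_
  rw [Matroid.isColoop_iff_notMem_closure_compl (Set.mem_univ e), not_not]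
  simp [Set.compl_eq_univ_sdiff]

/-- A circuit through `e` inside `A` exists exactly when `e` is in the closure of `A \ {e}`. -/
theorem isCyclicSet_iff {A : Set (DowlingElement r G)} :
    (dowlingMatroid r G).IsCyclicSet A ↔
      ∀ e ∈ A, ∀ x ∈ solutions (A \ {e}), Compatible x e := by
  simp only [← mem_closure_iff]
  constructor
  · rintro ⟨S, hS, rfl⟩ e ⟨C, hC, heC⟩
    exact (dowlingMatroid r G).closure_subset_closure
      (Set.sdiff_subset_sdiff_left (Set.subset_sUnion_of_mem hC))
      ((hS C hC).mem_closure_sdiff_singleton_of_mem heC)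
  · intro h
    refine ⟨{C | C ⊆ A ∧ (dowlingMatroid r G).IsCircuit C}, fun C hC => hC.2,
      Set.Subset.antisymm (fun e he => ?_) (Set.sUnion_subset fun C hC => hC.1)⟩
    obtain ⟨C, hCA, hC, heC⟩ :=
      (Matroid.mem_closure_iff_exists_isCircuit (fun h => h.2 rfl)).1 (h e he)
    exact ⟨C, ⟨hCA.trans (by simp [he]), hC⟩, heC⟩

open Classical in
-- A solution determined by its labels off `D` leaves at most `(|G| + 1) ^ (r - |D|)` possibilities.
-- The next lemma is the dual bound, from freely prescribed labels off `D`.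
theorem card_le_eRk {A : Set (DowlingElement r G)} (D : Finset (Fin r))
    (h : ∀ x ∈ solutions A, ∀ y ∈ solutions A, (∀ i ∉ D, x i = y i) → x = y) :
    (D.card : ℕ∞) ≤ (dowlingMatroid r G).eRk A := by
  rw [eRk_dowlingMatroid, Nat.cast_le]
  have hc : Nat.card (solutions A) ≤ Nat.card ({i // i ∉ D} → WithZero G) := by
    refine Nat.card_le_card_of_injective (fun x i => x.1 i.1) fun x y hxy => Subtype.ext ?_
    exact h x.1 x.2 y.1 y.2 fun i hi => congrFun hxy ⟨i, hi⟩
  have hD : Nat.card {i // i ∉ D} = r - D.card := by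
    rw [Nat.card_eq_fintype_card, Fintype.card_subtype_compl]
    simp
  rw [card_solutions, Nat.card_fun, card_withZero, hD,
    Nat.pow_le_pow_iff_right one_lt_card_withZero] at hc
  have := card_finset_fin_le D
  omega

open Classical in
theorem eRk_le_card {A : Set (DowlingElement r G)} (D : Finset (Fin r))
    (h : ∀ f : Fin r → WithZero G, ∃ x ∈ solutions A, ∀ i ∉ D, x i = f i) :
    (dowlingMatroid r G).eRk A ≤ D.card := by
  rw [eRk_dowlingMatroid, Nat.cast_le]
  have hc : Nat.card ({i // i ∉ D} → WithZero G) ≤ Nat.card (solutions A) := by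
    refine Nat.card_le_card_of_surjective (fun x i => x.1 i.1) fun f => ?_
    obtain ⟨x, hx, hxf⟩ := h fun i => if hi : i ∉ D then f ⟨i, hi⟩ else 0
    exact ⟨⟨x, hx⟩, funext fun i => by simp [hxf i.1 i.2, i.2]⟩
  have hD : Nat.card {i // i ∉ D} = r - D.card := by
    rw [Nat.card_eq_fintype_card, Fintype.card_subtype_compl]
    simp
  rw [card_solutions, Nat.card_fun, card_withZero, hD,
    Nat.pow_le_pow_iff_right one_lt_card_withZero] at hc
  omega

end Dowling

/-! ## The `G`-invariant of a Dowling matroid -/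

namespace Dowling

open DowlingElement

universe u v

variable {r : ℕ} {G : Type u} {H : Type v} [Group G] [Group H]

/-- The supports of the solutions of `A`. -/
def supports (A : Set (DowlingElement r G)) : Set (Set (Fin r)) :=
  (fun x => {i | x i ≠ 0}) '' solutions A

theorem supports_insert_subset (A : Set (DowlingElement r G)) (e : DowlingElement r G) :
    supports (insert e A) ⊆ supports A :=
  Set.image_mono (solutions_anti (Set.subset_insert e A))

theorem supports_insert_joint (A : Set (DowlingElement r G)) (i : Fin r) :
    supports (insert (joint i) A) = {S ∈ supports A | i ∉ S} := by
  ext S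
  constructor
  · rintro ⟨x, hx, rfl⟩
    rw [mem_solutions_insert_iff] at hx
    exact ⟨⟨x, hx.2, rfl⟩, fun h => h hx.1⟩
  · rintro ⟨⟨x, hx, rfl⟩, h⟩
    exact ⟨x, mem_solutions_insert_joint hx (not_not.1 h), rfl⟩

open Classical in
/-- If `i` and `j` lie in different components, then the label at `i` can be erased without
changing the label at `j`. -/
theorem exists_erase {A : Set (DowlingElement r G)} {x : Fin r → WithZero G}
    (hx : x ∈ solutions A) {i j : Fin r}
    (h : (graph A).connectedComponentMk i ≠ (graph A).connectedComponentMk j) :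
    ∃ y ∈ solutions A, y i = 0 ∧ y j = x j :=
  ⟨_, replace_mem hx (zero_mem_solutions A) 0 ((graph A).connectedComponentMk i),
    by simp, by simp [h.symm]⟩

open Classical in
/-- If `i` and `j` lie in different components, a solution that does not vanish there can be
rescaled to satisfy any gain from `i` to `j`, without changing its support. -/
theorem exists_rescale {A : Set (DowlingElement r G)} {x : Fin r → WithZero G}
    (hx : x ∈ solutions A) {i j : Fin r} (hi : x i ≠ 0) (hj : x j ≠ 0)
    (h : (graph A).connectedComponentMk i ≠ (graph A).connectedComponentMk j) (a : G) :
    ∃ y ∈ solutions A, y i * (a : WithZero G) = y j ∧ {k | y k ≠ 0} = {k | x k ≠ 0} := by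
  refine ⟨_, replace_mem hx hx (x j * (a : WithZero G)⁻¹ * (x i)⁻¹)
    ((graph A).connectedComponentMk i), ?_, ?_⟩
  · simp only [if_true, h.symm, if_false]
    rw [inv_mul_cancel_right₀ hi, inv_mul_cancel_right₀ WithZero.coe_ne_zero]
  · ext k
    simp only [Set.mem_ofPred_eq]
    split_ifs <;> simp [hi, hj]

/-- In different components, the label at `i` could be erased while that at `j` is kept, giving a
support that separates them. -/
theorem mk_eq_of_forall_supports {A : Set (DowlingElement r G)} {i j : Fin r}
    (h : ∀ S ∈ supports A, (i ∈ S ↔ j ∈ S)) {x : Fin r → WithZero G} (hx : x ∈ solutions A)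
    (hi : x i ≠ 0) :
    (graph A).connectedComponentMk i = (graph A).connectedComponentMk j := by
  by_contra hne
  obtain ⟨y, hy, hyi, hyj⟩ := exists_erase hx hne
  have h1 := h _ ⟨x, hx, rfl⟩
  have h2 := h _ ⟨y, hy, rfl⟩
  simp only [Set.mem_ofPred_eq] at h1 h2
  rw [hyi, hyj] at h2
  simp only [ne_eq, not_true_eq_false, false_iff] at h2
  exact h2 (h1.1 hi)

/-- The hypothesis forces `i` and `j` into different components whenever some solution is nonzero at
both. One component can then be rescaled to meet any gain, so the result does not depend on `a`. -/
theorem supports_insert_edge_of_separated {A : Set (DowlingElement r G)} {i j : Fin r}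
    (hij : i < j) (h : (∃ S ∈ supports A, ¬ (i ∈ S ↔ j ∈ S)) ∨ ∀ S ∈ supports A, i ∉ S) (a : G) :
    supports (insert (edge i j hij a) A) = {S ∈ supports A | i ∈ S ↔ j ∈ S} := by
  ext S
  constructor
  · rintro ⟨x, hx, rfl⟩
    rw [mem_solutions_insert_iff] at hx
    refine ⟨⟨x, hx.2, rfl⟩, ?_⟩
    have h1 : x i * (a : WithZero G) = x j := hx.1
    simp [← h1]
  · rintro ⟨⟨x, hx, rfl⟩, hS⟩
    simp only [Set.mem_ofPred_eq] at hS
    by_cases hi : x i = 0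
    · have hj : x j = 0 := by_contra fun hj => hS.2 hj hi
      exact ⟨x, mem_solutions_insert_edge hx (by simp [hi, hj]), rfl⟩
    · have hj := hS.1 hi
      have hne : (graph A).connectedComponentMk i ≠ (graph A).connectedComponentMk j := by
        intro hm
        rcases h with ⟨_, ⟨z, hz, rfl⟩, hz'⟩ | h
        · exact hz' (not_congr (solutions_zero_iff hz hm))
        · exact h _ ⟨x, hx, rfl⟩ hi
      obtain ⟨y, hy, hya, hyx⟩ := exists_rescale hx hi hj hne a
      exact ⟨y, mem_solutions_insert_edge hy hya, hyx⟩

open Classical in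
-- Rescale `y` on the component until it agrees with `x` at `i`; the two then agree on the whole
-- component.
theorem mul_eq_of_mk_eq {A : Set (DowlingElement r G)} {x y : Fin r → WithZero G} {i j : Fin r}
    (hx : x ∈ solutions A) (hy : y ∈ solutions A)
    (hm : (graph A).connectedComponentMk i = (graph A).connectedComponentMk j)
    (hi : y i ≠ 0) {a : G} (h : y i * (a : WithZero G) = y j) :
    x i * (a : WithZero G) = x j := by
  have hz := replace_mem hx hy (x i * (y i)⁻¹) ((graph A).connectedComponentMk i)
  have key := solutions_eq_of_mk_eq hz hx hm (by
    simp only [if_true]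
    exact inv_mul_cancel_right₀ hi _)
  simp only [← hm, if_true] at key
  rw [← key, ← h, ← mul_assoc, inv_mul_cancel_right₀ hi]

open Classical in
-- Here `A` already implies a gain `c` from `i` to `j`. Any other gain contradicts it unless the
-- labels at `i` and `j` vanish.
theorem supports_insert_edge_of_not_separated {A : Set (DowlingElement r G)} {i j : Fin r}
    (hij : i < j) (h : ∀ S ∈ supports A, (i ∈ S ↔ j ∈ S)) (h' : ∃ S ∈ supports A, i ∈ S) :
    ∃ c : G, ∀ a : G, supports (insert (edge i j hij a) A) =
      if a = c then supports A else {S ∈ supports A | i ∉ S} := by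
  obtain ⟨_, ⟨x, hx, rfl⟩, hi⟩ := h'
  have hi : x i ≠ 0 := hi
  have hj : x j ≠ 0 := (h _ ⟨x, hx, rfl⟩).1 hi
  have hm := mk_eq_of_forall_supports h hx hi
  obtain ⟨b, hb⟩ := WithZero.ne_zero_iff_exists.1 hi
  obtain ⟨d, hd⟩ := WithZero.ne_zero_iff_exists.1 hj
  have hc : x i * ((b⁻¹ * d : G) : WithZero G) = x j := by
    rw [← hb, ← hd, ← WithZero.coe_mul, mul_inv_cancel_left]
  refine ⟨b⁻¹ * d, fun a => ?_⟩
  split_ifs with ha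
  · rw [ha]
    refine (supports_insert_subset _ _).antisymm ?_
    rintro _ ⟨y, hy, rfl⟩
    exact ⟨y, mem_solutions_insert_edge hy (mul_eq_of_mk_eq hy hx hm hi hc), rfl⟩
  · ext S
    constructor
    · rintro ⟨y, hy, rfl⟩
      rw [mem_solutions_insert_iff] at hy
      refine ⟨⟨y, hy.2, rfl⟩, fun hyi => ha ?_⟩
      have h1 : x i * (a : WithZero G) = x j := mul_eq_of_mk_eq hx hy.2 hm hyi hy.1
      rw [← hc] at h1
      exact WithZero.coe_injective (mul_left_cancel₀ hi h1)
    · rintro ⟨⟨y, hy, rfl⟩, hyi⟩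
      have hyj : ¬ y j ≠ 0 := (h _ ⟨y, hy, rfl⟩).not.1 hyi
      rw [Set.mem_ofPred_eq, not_not] at hyi
      rw [not_not] at hyj
      exact ⟨y, mem_solutions_insert_edge hy (by simp [hyi, hyj]), rfl⟩

/-- Supports therefore detect whether the rank grows. A solution `x` of `A` shares its support with
a solution `y` that respects `e`, and for an edge nonzero on `y` the gain passes from `y` to `x`
within their common component. -/
theorem supports_insert_eq_iff {A : Set (DowlingElement r G)} {e : DowlingElement r G} :
    supports (insert e A) = supports A ↔ solutions (insert e A) = solutions A := by
  refine ⟨fun h => solutions_insert_eq_iff.2 fun x hx => ?_, fun h => by rw [supports, h]; rfl⟩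
  obtain ⟨y, hy, hyx⟩ : {k | x k ≠ 0} ∈ supports (insert e A) := h ▸ ⟨x, hx, rfl⟩
  rw [mem_solutions_insert_iff] at hy
  have hyx : ∀ k, y k = 0 ↔ x k = 0 := fun k => not_iff_not.1 (Set.ext_iff.1 hyx k)
  cases e with
  | joint i => exact (hyx i).1 hy.1
  | edge i j hij a =>
    have hya : y i * (a : WithZero G) = y j := hy.1
    by_cases hi : y i = 0
    · have hj : y j = 0 := by rw [← hya, hi, zero_mul]
      rw [hyx] at hi hj
      change x i * _ = x j
      rw [hi, hj, zero_mul]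
    · refine mul_eq_of_mk_eq hx hy.2 (mk_eq_of_forall_supports ?_ hy.2 hi) hi hya
      intro S hS
      rw [← h] at hS
      obtain ⟨z, hz, rfl⟩ := hS
      have hza : z i * (a : WithZero G) = z j := (mem_solutions_insert_iff.1 hz).1
      simp [← hza]

open Classical in
theorem exists_equiv_supports_insert_edge [Finite G] [Finite H] (hGH : Nat.card G = Nat.card H)
    {A : Set (DowlingElement r G)} {B : Set (DowlingElement r H)} (h : supports A = supports B)
    {i j : Fin r} (hij : i < j) :
    ∃ ψ : G ≃ H, ∀ a, supports (insert (edge i j hij a) A) =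
      supports (insert (edge i j hij (ψ a)) B) := by
  obtain ⟨e⟩ : Nonempty (G ≃ H) := Finite.card_eq.1 hGH
  by_cases hs : (∃ S ∈ supports A, ¬ (i ∈ S ↔ j ∈ S)) ∨ ∀ S ∈ supports A, i ∉ S
  · refine ⟨e, fun a => ?_⟩
    rw [supports_insert_edge_of_separated hij hs, h,
      supports_insert_edge_of_separated hij (h ▸ hs)]
  · push Not at hs
    obtain ⟨c, hc⟩ := supports_insert_edge_of_not_separated hij hs.1 hs.2
    rw [h] at hs
    obtain ⟨d, hd⟩ := supports_insert_edge_of_not_separated hij hs.1 hs.2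
    -- The swap makes the bijection send the exceptional gain `c` to the exceptional gain `d`.
    refine ⟨e.trans (Equiv.swap (e c) d), fun a => ?_⟩
    have key : (e.trans (Equiv.swap (e c) d)) a = d ↔ a = c := by
      rw [Equiv.trans_apply, ← Equiv.eq_symm_apply, Equiv.symm_swap, Equiv.swap_apply_right,
        e.apply_eq_iff_eq]
    simp only [hc, hd, key, h]

/-- A family of bijections between the gains, one for every pair of indices, induces a bijection
between the ground sets. -/
def elementEquiv (ψ : ∀ i j : Fin r, i < j → (G ≃ H)) :
    DowlingElement r G ≃ DowlingElement r H where
  toFun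
    | joint i => joint i
    | edge i j hij a => edge i j hij (ψ i j hij a)
  invFun
    | joint i => joint i
    | edge i j hij a => edge i j hij ((ψ i j hij).symm a)
  left_inv := by rintro (i | ⟨i, j, hij, a⟩) <;> simp
  right_inv := by rintro (i | ⟨i, j, hij, a⟩) <;> simp

theorem exists_equiv_supports_insert [Finite G] [Finite H] (hGH : Nat.card G = Nat.card H)
    {A : Set (DowlingElement r G)} {B : Set (DowlingElement r H)} (h : supports A = supports B) :
    ∃ ψ : DowlingElement r G ≃ DowlingElement r H, ∀ e,
      supports (insert e A) = supports (insert (ψ e) B) := by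
  choose ψ hψ using fun (i j : Fin r) (hij : i < j) =>
    exists_equiv_supports_insert_edge hGH h hij
  refine ⟨elementEquiv ψ, ?_⟩
  rintro (i | ⟨i, j, hij, a⟩)
  · change _ = supports (insert (joint i) B)
    rw [supports_insert_joint, supports_insert_joint, h]
  · exact hψ i j hij a

/-- If `f` and `g` have fibres of equal size, and are constant with the same value on sets `A` and
`B` of equal size, then they have fibres of equal size on the complements of these sets. -/
theorem exists_equiv_compl {α β γ : Type*} [Finite α] [Finite β] {f : α → γ} {g : β → γ}
    (ψ : α ≃ β) (hψ : ∀ a, f a = g (ψ a)) {A : Set α} {B : Set β} {c : γ}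
    (hA : ∀ a ∈ A, f a = c) (hB : ∀ b ∈ B, g b = c) (hAB : A.ncard = B.ncard) :
    ∃ ε : {a // a ∉ A} ≃ {b // b ∉ B}, ∀ a, f a.1 = g (ε a).1 := by
  have hcard : ∀ s, ({a | f a = s} \ A).ncard = ({b | g b = s} \ B).ncard := by
    intro s
    have hfib : {a | f a = s}.ncard = {b | g b = s}.ncard := by
      rw [← Set.ncard_image_of_injective _ ψ.injective]
      congr 1
      ext b
      simp [hψ, Equiv.image_eq_preimage_symm]
    by_cases hs : s = c
    · subst hs
      have hA' : A ⊆ {a | f a = s} := hA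
      have hB' : B ⊆ {b | g b = s} := hB
      rw [Set.ncard_sdiff hA' (Set.toFinite _), Set.ncard_sdiff hB' (Set.toFinite _), hfib, hAB]
    · have hA' : Disjoint {a | f a = s} A :=
        Set.disjoint_left.2 fun a ha haA => hs (ha.symm.trans (hA a haA))
      have hB' : Disjoint {b | g b = s} B :=
        Set.disjoint_left.2 fun b hb hbB => hs (hb.symm.trans (hB b hbB))
      rw [hA'.sdiff_eq_left, hB'.sdiff_eq_left, hfib]
  have hfibre : ∀ s, Nonempty
      ({a : {a // a ∉ A} // f a.1 = s} ≃ {b : {b // b ∉ B} // g b.1 = s}) := by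
    intro s
    rw [← Finite.card_eq,
      Nat.card_congr (Equiv.subtypeSubtypeEquivSubtypeInter (· ∉ A) (fun a => f a = s)),
      Nat.card_congr (Equiv.subtypeSubtypeEquivSubtypeInter (· ∉ B) (fun b => g b = s))]
    convert hcard s using 1 <;> rw [← Nat.card_coe_set_eq] <;>
      exact Nat.card_congr (Equiv.subtypeEquivRight fun _ => and_comm)
  exact ⟨Equiv.ofFiberEquiv (fun s => Classical.choice (hfibre s)),
    fun a => (Equiv.ofFiberEquiv_map (f := fun a : {a // a ∉ A} => f a.1)
      (g := fun b : {b // b ∉ B} => g b.1) _ a).symm⟩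

/-- The rank increments along the sequence `f`, started at the set `A`. -/
noncomputable def rankSteps {α : Type*} (M : Matroid α) (A : Set α) {m : ℕ} (f : Fin m → α) :
    List ℕ :=
  List.ofFn fun j : Fin m =>
    (M.eRk (A ∪ f '' Set.Iic j)).toNat - (M.eRk (A ∪ f '' Set.Iio j)).toNat

theorem rankSteps_cons {α : Type*} (M : Matroid α) (A : Set α) {m : ℕ} (e : α) (f : Fin m → α) :
    rankSteps M A (Fin.cons e f : Fin (m + 1) → α) =
      ((M.eRk (insert e A)).toNat - (M.eRk A).toNat) :: rankSteps M (insert e A) f := by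
  have h0 : (Set.Iic 0 : Set (Fin (m + 1))) = {0} := by ext k; simp
  have h0' : (Set.Iio 0 : Set (Fin (m + 1))) = ∅ := by ext k; simp
  have h1 : ∀ j : Fin m, (Fin.cons e f : Fin (m + 1) → α) '' Set.Iic j.succ =
      insert e (f '' Set.Iic j) := by
    intro j
    ext x
    simp [Fin.exists_fin_succ, eq_comm]
  have h2 : ∀ j : Fin m, (Fin.cons e f : Fin (m + 1) → α) '' Set.Iio j.succ =
      insert e (f '' Set.Iio j) := by
    intro j
    ext x
    simp [Fin.exists_fin_succ, eq_comm]
  simp only [rankSteps, List.ofFn_succ, h0, h0', h1, h2, Set.image_singleton, Fin.cons_zero,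
    Set.image_empty, Set.union_empty, Set.union_insert, Set.insert_union, Set.union_singleton]

/-- An injective sequence that avoids `A` is a first element outside `A` and an injective sequence
that avoids both. -/
def consEquivAvoiding {α : Type*} (A : Set α) (m : ℕ) :
    (Σ e : {e // e ∉ A}, {f : Fin m → α // Function.Injective f ∧ ∀ k, f k ∉ insert e.1 A}) ≃
      {f : Fin (m + 1) → α // Function.Injective f ∧ ∀ k, f k ∉ A} where
  toFun p := ⟨Fin.cons p.1.1 p.2.1, by
    have h := p.2.2.2
    simp only [Set.mem_insert_iff, not_or] at h
    refine ⟨Fin.cons_injective_iff.2 ⟨?_, p.2.2.1⟩, fun k => ?_⟩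
    · rintro ⟨k, hk⟩
      exact (h k).1 hk
    · cases k using Fin.cases with
      | zero => exact p.1.2
      | succ k => exact (h k).2⟩
  invFun f := ⟨⟨f.1 0, f.2.2 0⟩, Fin.tail f.1, by
    refine ⟨fun k l hkl => Fin.succ_injective _ (f.2.1 hkl), fun k => ?_⟩
    simp only [Set.mem_insert_iff, not_or]
    exact ⟨fun h => Fin.succ_ne_zero k (f.2.1 h), f.2.2 _⟩⟩
  left_inv p := rfl
  right_inv f := Subtype.ext (Fin.cons_self_tail f.1)

theorem supports_empty : supports (∅ : Set (DowlingElement r G)) = Set.univ := by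
  classical
  refine Set.eq_univ_of_forall fun S => ⟨fun i => if i ∈ S then 1 else 0, ?_, ?_⟩
  · simp [solutions]
  · ext i
    simp

/-! ### Matching the orderings of two Dowling matroids -/

variable [Finite G] [Finite H]

theorem exists_equiv_rankSteps (hGH : Nat.card G = Nat.card H) (m : ℕ) :
    ∀ (A : Set (DowlingElement r G)) (B : Set (DowlingElement r H)),
      supports A = supports B → numBalanced A = numBalanced B → A.ncard = B.ncard →
      ∃ Φ : {f : Fin m → DowlingElement r G // Function.Injective f ∧ ∀ k, f k ∉ A} ≃
          {f : Fin m → DowlingElement r H // Function.Injective f ∧ ∀ k, f k ∉ B},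
        ∀ f, rankSteps (dowlingMatroid r G) A f.1 = rankSteps (dowlingMatroid r H) B (Φ f).1 := by
  induction m with
  | zero =>
    intro A B _ _ _
    have : Unique {f : Fin 0 → DowlingElement r G // Function.Injective f ∧ ∀ k, f k ∉ A} :=
      ⟨⟨⟨Fin.elim0, fun k => k.elim0, fun k => k.elim0⟩⟩,
        fun f => Subtype.ext (Subsingleton.elim _ _)⟩
    have : Unique {f : Fin 0 → DowlingElement r H // Function.Injective f ∧ ∀ k, f k ∉ B} :=
      ⟨⟨⟨Fin.elim0, fun k => k.elim0, fun k => k.elim0⟩⟩,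
        fun f => Subtype.ext (Subsingleton.elim _ _)⟩
    exact ⟨Equiv.ofUnique _ _, fun f => by simp [rankSteps]⟩
  | succ m ih =>
    intro A B hS hb hn
    obtain ⟨ψ, hψ⟩ := exists_equiv_supports_insert hGH hS
    -- `ψ` need not carry `A` to `B`, but the elements of both leave the supports unchanged, so the
    -- fibres still match in size once they are removed.
    obtain ⟨ε, hε⟩ := exists_equiv_compl (f := fun e => supports (insert e A))
      (g := fun e => supports (insert e B)) ψ hψ (c := supports A)
      (fun e he => by rw [Set.insert_eq_of_mem he])
      (fun e he => by rw [Set.insert_eq_of_mem he, hS]) hn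
    have hnum : ∀ e, numBalanced (insert e.1 A) = numBalanced (insert (ε e).1 B) := by
      intro e
      have h1 := numBalanced_le_insert A e.1
      have h2 := numBalanced_anti (Set.subset_insert e.1 A)
      have h3 := numBalanced_le_insert B (ε e).1
      have h4 := numBalanced_anti (Set.subset_insert (ε e).1 B)
      have h5 : numBalanced A = numBalanced (insert e.1 A) ↔
          numBalanced B = numBalanced (insert (ε e).1 B) := by
        rw [numBalanced_eq_iff_solutions_eq (Set.subset_insert _ _),
          numBalanced_eq_iff_solutions_eq (Set.subset_insert _ _), ← supports_insert_eq_iff,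
          ← supports_insert_eq_iff, hε, hS]
      omega
    have hcard : ∀ e, (insert e.1 A).ncard = (insert (ε e).1 B).ncard := by
      intro e
      rw [Set.ncard_insert_of_notMem e.2 (Set.toFinite _),
        Set.ncard_insert_of_notMem (ε e).2 (Set.toFinite _), hn]
    -- The matching of the remaining elements may depend on the first element `e`.
    choose Φ hΦ using fun e => ih _ _ (hε e) (hnum e) (hcard e)
    refine ⟨(consEquivAvoiding A m).symm.trans
      ((Equiv.sigmaCongr ε Φ).trans (consEquivAvoiding B m)), fun f => ?_⟩
    obtain ⟨⟨e, f⟩, rfl⟩ := (consEquivAvoiding A m).surjective f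
    simp only [Equiv.trans_apply, Equiv.symm_apply_apply]
    change rankSteps _ A (Fin.cons e.1 f.1 : Fin (m + 1) → _) =
      rankSteps _ B (Fin.cons (ε e).1 (Φ e f).1 : Fin (m + 1) → _)
    rw [rankSteps_cons, rankSteps_cons, hΦ e f]
    simp only [eRk_dowlingMatroid, hnum e, hb]

/-- The orderings of the ground set are the injective sequences of full length. -/
noncomputable def orderingEquiv {n : ℕ} (hn : Nat.card (DowlingElement r G) = n) :
    (Fin n ≃ (dowlingMatroid r G).E) ≃
      {f : Fin n → DowlingElement r G //
        Function.Injective f ∧ ∀ k, f k ∉ (∅ : Set (DowlingElement r G))} where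
  toFun π := ⟨fun k => (π k).1, Subtype.val_injective.comp π.injective, fun _ => id⟩
  invFun f := (Equiv.ofBijective f.1 (f.2.1.bijective_of_nat_card_le (by simp [hn]))).trans
    (Equiv.Set.univ _).symm
  left_inv π := Equiv.ext fun k => rfl
  right_inv f := rfl

theorem gInvariant_eq_finsum {n : ℕ} (hn : Nat.card (DowlingElement r G) = n) :
    (dowlingMatroid r G).gInvariant =
      ∑ᶠ f : {f : Fin n → DowlingElement r G //
        Function.Injective f ∧ ∀ k, f k ∉ (∅ : Set (DowlingElement r G))},
        Finsupp.single (rankSteps (dowlingMatroid r G) ∅ f.1) (1 : ℚ) := by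
  have hE : (dowlingMatroid r G).E.ncard = n := by
    rw [dowlingMatroid_E, Set.ncard_univ, hn]
  subst hE
  rw [Matroid.gInvariant, ← finsum_comp_equiv (orderingEquiv hn)]
  refine finsum_congr fun π => ?_
  simp only [Matroid.rankSequence, rankSteps, Set.empty_union]
  rfl

theorem gInvariant_eq (hGH : Nat.card G = Nat.card H) :
    (dowlingMatroid r G).gInvariant = (dowlingMatroid r H).gInvariant := by
  have hS : supports (∅ : Set (DowlingElement r G)) =
      supports (∅ : Set (DowlingElement r H)) := by rw [supports_empty, supports_empty]
  obtain ⟨ψ, -⟩ := exists_equiv_supports_insert hGH hS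
  obtain ⟨Φ, hΦ⟩ := exists_equiv_rankSteps hGH (Nat.card (DowlingElement r H)) ∅ ∅ hS
    (by rw [numBalanced_empty, numBalanced_empty]) (by simp)
  rw [gInvariant_eq_finsum (Nat.card_congr ψ), gInvariant_eq_finsum rfl, ← finsum_comp_equiv Φ]
  exact finsum_congr fun f => by rw [hΦ]

end Dowling

/-! ## Cyclic flats of small rank -/

namespace Dowling

open DowlingElement

universe u

variable {r : ℕ} {G : Type u}

variable (G) in
/-- All elements that are supported on the index set `S`. -/
def full (S : Finset (Fin r)) : Set (DowlingElement r G)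
  | joint i => i ∈ S
  | edge i j _ _ => i ∈ S ∧ j ∈ S

theorem joint_mem_full {S : Finset (Fin r)} {i : Fin r} : joint i ∈ full G S ↔ i ∈ S := Iff.rfl

theorem edge_mem_full {S : Finset (Fin r)} {i j : Fin r} {hij : i < j} {a : G} :
    edge i j hij a ∈ full G S ↔ i ∈ S ∧ j ∈ S := Iff.rfl

theorem full_mono {S T : Finset (Fin r)} (h : S ⊆ T) : full G S ⊆ full G T := by
  rintro (i | ⟨i, j, hij, a⟩) he
  · exact h he
  · exact ⟨h he.1, h he.2⟩

theorem full_subset_full_iff {S T : Finset (Fin r)} : full G S ⊆ full G T ↔ S ⊆ T :=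
  ⟨fun h i hi => h (a := joint i) hi, full_mono⟩

/-- The increasing pairs of elements of `S`. -/
def ltPairs (S : Finset (Fin r)) : Finset (Fin r × Fin r) := {p ∈ S ×ˢ S | p.1 < p.2}

/-- `S ×ˢ S` splits into increasing pairs, decreasing pairs and the diagonal. The form without
division suits `omega` once `S.card` is a numeral. -/
theorem card_ltPairs (S : Finset (Fin r)) :
    2 * (ltPairs S).card + S.card = S.card * S.card := by
  have h1 := Finset.card_filter_add_card_filter_not (s := S ×ˢ S) (fun p => p.1 < p.2)
  have h2 := Finset.card_filter_add_card_filter_not (s := {p ∈ S ×ˢ S | ¬ p.1 < p.2})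
    (fun p => p.2 < p.1)
  have h3 : ({p ∈ {p ∈ S ×ˢ S | ¬ p.1 < p.2} | p.2 < p.1}).card = (ltPairs S).card := by
    refine Finset.card_bij (fun p _ => p.swap) ?_ ?_ ?_
    · simp only [ltPairs, Finset.mem_filter, Finset.mem_product]
      exact fun p hp => ⟨hp.1.1.symm, hp.2⟩
    · exact fun p _ q _ h => Prod.swap_injective h
    · simp only [ltPairs, Finset.mem_filter, Finset.mem_product]
      exact fun p hp => ⟨p.swap, ⟨⟨hp.1.symm, hp.2.not_gt⟩, hp.2⟩, p.swap_swap⟩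
  have h4 : ({p ∈ {p ∈ S ×ˢ S | ¬ p.1 < p.2} | ¬ p.2 < p.1}).card = S.card := by
    refine (Finset.card_bij (fun i _ => (i, i)) ?_ ?_ ?_).symm
    · simp
    · exact fun i _ j _ h => congrArg Prod.fst h
    · simp only [Finset.mem_filter, Finset.mem_product, Prod.forall, Prod.mk.injEq]
      exact fun i j h => ⟨i, h.1.1.1, rfl, le_antisymm (not_lt.1 h.2) (not_lt.1 h.1.2)⟩
  rw [Finset.card_product] at h1
  change (ltPairs S).card + _ = _ at h1
  omega

variable (G) in
/-- The elements of a full set are its joints and, for every pair of indices, the elements of the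
group. -/
def fullEquiv (S : Finset (Fin r)) : full G S ≃ S ⊕ (ltPairs S × G) where
  toFun
    | ⟨joint i, h⟩ => Sum.inl ⟨i, h⟩
    | ⟨edge i j hij a, h⟩ => Sum.inr (⟨(i, j), by simp [ltPairs, h.1, h.2, hij]⟩, a)
  invFun
    | Sum.inl i => ⟨joint i.1, i.2⟩
    | Sum.inr (p, a) => ⟨edge p.1.1 p.1.2 (Finset.mem_filter.1 p.2).2 a,
        Finset.mem_product.1 (Finset.mem_filter.1 p.2).1⟩
  left_inv := by rintro ⟨i | ⟨i, j, hij, a⟩, h⟩ <;> rfl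
  right_inv := by rintro (i | ⟨p, a⟩) <;> rfl

theorem encard_full [Finite G] (S : Finset (Fin r)) :
    (full G S).encard = (S.card + (ltPairs S).card * Nat.card G : ℕ) := by
  rw [← (Set.toFinite _).cast_ncard_eq, ← Nat.card_coe_set_eq, Nat.card_congr (fullEquiv G S),
    Nat.card_sum, Nat.card_prod]
  simp

/-! ### Blocks and their potentials -/

variable [Group G]

/-- The elements `a_{ij}` with `i, j ∈ S` whose gains come from the potential `θ`. -/
def block (S : Finset (Fin r)) (θ : Fin r → G) : Set (DowlingElement r G)
  | joint _ => False
  | edge i j _ a => i ∈ S ∧ j ∈ S ∧ θ i * a = θ j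

theorem block_subset_full (S : Finset (Fin r)) (θ : Fin r → G) : block S θ ⊆ full G S := by
  rintro (i | ⟨i, j, hij, a⟩) he
  · exact he.elim
  · exact ⟨he.1, he.2.1⟩

/-- A block on a single index is empty, hence the bound on `S.card`. -/
theorem subset_of_block_subset {S T : Finset (Fin r)} {θ : Fin r → G} (hS : 2 ≤ S.card)
    (h : block S θ ⊆ full G T) : S ⊆ T := by
  intro i hi
  obtain ⟨j, hj, hji⟩ := Finset.exists_mem_ne hS i
  rcases lt_or_gt_of_ne hji with hlt | hlt
  · exact (h (a := edge j i hlt ((θ j)⁻¹ * θ i)) ⟨hj, hi, by group⟩).2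
  · exact (h (a := edge i j hlt ((θ i)⁻¹ * θ j)) ⟨hi, hj, by group⟩).1

theorem ratio_eq_of_block_subset {S T : Finset (Fin r)} {θ η : Fin r → G}
    (h : block S θ ⊆ block T η) {i j : Fin r} (hi : i ∈ S) (hj : j ∈ S) :
    (θ i)⁻¹ * θ j = (η i)⁻¹ * η j := by
  rcases lt_trichotomy i j with hlt | rfl | hlt
  · have := (h (a := edge i j hlt ((θ i)⁻¹ * θ j)) ⟨hi, hj, by group⟩).2.2
    rw [← this, inv_mul_cancel_left]
  · simp
  · have := (h (a := edge j i hlt ((θ j)⁻¹ * θ i)) ⟨hj, hi, by group⟩).2.2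
    rw [← this]
    group

theorem block_subset_block {S T : Finset (Fin r)} {θ η : Fin r → G} (hST : S ⊆ T)
    (h : ∀ i ∈ S, ∀ j ∈ S, (θ i)⁻¹ * θ j = (η i)⁻¹ * η j) : block S θ ⊆ block T η := by
  rintro (i | ⟨i, j, hij, a⟩) he
  · exact he.elim
  · refine ⟨hST he.1, hST he.2.1, ?_⟩
    have h1 := h i he.1 j he.2.1
    rw [← he.2.2, inv_mul_cancel_left] at h1
    rw [h1, mul_inv_cancel_left]

/-- A block determines its potential only up to a left factor on `S`, so potentials are compared
through their ratios. -/
theorem block_eq_block_iff {S : Finset (Fin r)} {θ η : Fin r → G} :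
    block S θ = block S η ↔ ∀ i ∈ S, ∀ j ∈ S, (θ i)⁻¹ * θ j = (η i)⁻¹ * η j :=
  ⟨fun h _ hi _ hj => ratio_eq_of_block_subset h.subset hi hj,
    fun h => (block_subset_block subset_rfl h).antisymm
      (block_subset_block subset_rfl fun i hi j hj => (h i hi j hj).symm)⟩

/-- A general `A` in place of a block lets this apply to a block with one element removed. -/
theorem mul_inv_eq_mul_inv_of_mem {A : Set (DowlingElement r G)} {θ : Fin r → G}
    {x : Fin r → WithZero G} (hx : x ∈ solutions A) {i j : Fin r}
    (h : ∀ hij : i < j, edge i j hij ((θ i)⁻¹ * θ j) ∈ A)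
    (h' : ∀ hji : j < i, edge j i hji ((θ j)⁻¹ * θ i) ∈ A) :
    x i * ((θ i)⁻¹ : G) = x j * ((θ j)⁻¹ : G) := by
  rcases lt_trichotomy i j with hlt | rfl | hlt
  · rw [← hx.2 i j hlt _ (h hlt), mul_assoc, ← WithZero.coe_mul, mul_inv_cancel_right]
  · rfl
  · rw [← hx.2 j i hlt _ (h' hlt), mul_assoc, ← WithZero.coe_mul, mul_inv_cancel_right]

theorem mem_solutions_block_iff {S : Finset (Fin r)} {θ : Fin r → G} {x : Fin r → WithZero G} :
    x ∈ solutions (block S θ) ↔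
      ∀ i ∈ S, ∀ j ∈ S, x i * ((θ i)⁻¹ : G) = x j * ((θ j)⁻¹ : G) := by
  constructor
  · intro hx i hi j hj
    exact mul_inv_eq_mul_inv_of_mem hx (fun _ => ⟨hi, hj, by group⟩) (fun _ => ⟨hj, hi, by group⟩)
  · refine fun h => ⟨fun i hi => hi.elim, fun i j hij a ha => ?_⟩
    obtain rfl : a = (θ i)⁻¹ * θ j := by rw [← ha.2.2, inv_mul_cancel_left]
    rw [WithZero.coe_mul, ← mul_assoc, h i ha.1 j ha.2.1, mul_assoc, ← WithZero.coe_mul]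
    simp

theorem mem_solutions_full_iff {S : Finset (Fin r)} {x : Fin r → WithZero G} :
    x ∈ solutions (full G S) ↔ ∀ i ∈ S, x i = 0 := by
  refine ⟨fun hx i hi => hx.1 i hi, fun h => ⟨fun i hi => h i hi, fun i j hij a ha => ?_⟩⟩
  rw [h i ha.1, h j ha.2, zero_mul]

open Classical in
theorem single_mem_solutions_full {S : Finset (Fin r)} {i : Fin r} (hi : i ∉ S) :
    (Pi.single i 1 : Fin r → WithZero G) ∈ solutions (full G S) :=
  mem_solutions_full_iff.2 fun j hj => Pi.single_eq_of_ne (by rintro rfl; exact hi hj) _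

open Classical in
theorem not_compatible_single_edge {i j : Fin r} {hij : i < j} {a : G} {k : Fin r}
    (hk : k = i ∨ k = j) : ¬ Compatible (Pi.single k 1 : Fin r → WithZero G) (edge i j hij a) := by
  rintro h
  have h : (Pi.single k 1 : Fin r → WithZero G) i * (a : WithZero G) =
    (Pi.single k 1 : Fin r → WithZero G) j := h
  rcases hk with rfl | rfl
  · simp [hij.ne'] at h
  · simp [hij.ne] at h

/-! ### Flatness, cyclicity, rank and size of blocks and full sets -/

variable [Finite G]

/-- The potential `θ` is itself a nowhere zero solution, which excludes joints and wrong gains; the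
indicator of an index outside `S` excludes the edges at that index. -/
theorem isFlat_block (S : Finset (Fin r)) (θ : Fin r → G) :
    (dowlingMatroid r G).IsFlat (block S θ) := by
  classical
  rw [isFlat_iff]
  have hθ : (fun i => (θ i : WithZero G)) ∈ solutions (block S θ) := by
    rw [mem_solutions_block_iff]
    intro i _ j _
    simp
  rintro (i | ⟨i, j, hij, a⟩) he
  · exact absurd (he _ hθ) WithZero.coe_ne_zero
  · have hmem : ∀ k, k = i ∨ k = j → k ∈ S := fun k hk => by_contra fun hkS =>
      not_compatible_single_edge hk
        (he _ (solutions_anti (block_subset_full S θ) (single_mem_solutions_full hkS)))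
    exact ⟨hmem i (Or.inl rfl), hmem j (Or.inr rfl), WithZero.coe_injective (he _ hθ)⟩

theorem isFlat_full (S : Finset (Fin r)) : (dowlingMatroid r G).IsFlat (full G S) := by
  classical
  rw [isFlat_iff]
  rintro (i | ⟨i, j, hij, a⟩) he
  · refine by_contra fun hi => ?_
    have h : (Pi.single i 1 : Fin r → WithZero G) i = 0 := he _ (single_mem_solutions_full hi)
    simp at h
  · have hmem : ∀ k, k = i ∨ k = j → k ∈ S := fun k hk => by_contra fun hkS =>
      not_compatible_single_edge hk (he _ (single_mem_solutions_full hkS))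
    exact ⟨hmem i (Or.inl rfl), hmem j (Or.inr rfl)⟩

/-- A third index `k` completes a triangle whose other two edges imply the removed one. -/
theorem isCyclicSet_block {S : Finset (Fin r)} (hS : 3 ≤ S.card) (θ : Fin r → G) :
    (dowlingMatroid r G).IsCyclicSet (block S θ) := by
  rw [isCyclicSet_iff]
  rintro (i | ⟨i, j, hij, a⟩) he x hx
  · exact he.elim
  · obtain ⟨hi, hj, ha⟩ := he
    obtain ⟨k, hk, hki, hkj⟩ : ∃ k ∈ S, k ≠ i ∧ k ≠ j := by
      by_contra! hcon
      have hsub : S ⊆ {i, j} := fun k hk => by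
        by_cases hki : k = i
        · simp [hki]
        · simp [hcon k hk hki]
      have := (Finset.card_le_card hsub).trans Finset.card_le_two
      omega
    have h1 : x i * ((θ i)⁻¹ : G) = x k * ((θ k)⁻¹ : G) :=
      mul_inv_eq_mul_inv_of_mem hx
        (fun _ => ⟨⟨hi, hk, by group⟩, by simp [hkj]⟩)
        (fun _ => ⟨⟨hk, hi, by group⟩, by simp [hki]⟩)
    have h2 : x j * ((θ j)⁻¹ : G) = x k * ((θ k)⁻¹ : G) :=
      mul_inv_eq_mul_inv_of_mem hx
        (fun _ => ⟨⟨hj, hk, by group⟩, by simp [hij.ne']⟩)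
        (fun _ => ⟨⟨hk, hj, by group⟩, by simp [hki]⟩)
    change x i * (a : WithZero G) = x j
    obtain rfl : a = (θ i)⁻¹ * θ j := by rw [← ha, inv_mul_cancel_left]
    rw [WithZero.coe_mul, ← mul_assoc, h1, ← h2, mul_assoc, ← WithZero.coe_mul]
    simp

theorem isCyclicSet_full {S : Finset (Fin r)} (hS : 2 ≤ S.card) :
    (dowlingMatroid r G).IsCyclicSet (full G S) := by
  rw [isCyclicSet_iff]
  rintro (i | ⟨i, j, hij, a⟩) he x hx
  · obtain ⟨j, hj, hji⟩ := Finset.exists_mem_ne hS i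
    have h0 : x j = 0 := hx.1 j ⟨hj, by simpa using hji⟩
    change x i = 0
    rcases lt_or_gt_of_ne hji with hlt | hlt
    · rw [← hx.2 j i hlt 1 ⟨⟨hj, he⟩, by simp⟩, h0, zero_mul]
    · have h1 := hx.2 i j hlt 1 ⟨⟨he, hj⟩, by simp⟩
      rwa [h0, mul_coe_eq_zero_iff] at h1
  · change x i * (a : WithZero G) = x j
    rw [hx.1 i ⟨he.1, by simp⟩, hx.1 j ⟨he.2, by simp⟩, zero_mul]

theorem eRk_full (S : Finset (Fin r)) : (dowlingMatroid r G).eRk (full G S) = S.card := by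
  classical
  refine le_antisymm (eRk_le_card S fun f => ?_) (card_le_eRk S fun x hx y hy h => ?_)
  · exact ⟨fun i => if i ∈ S then 0 else f i, mem_solutions_full_iff.2 fun i hi => by simp [hi],
      fun i hi => by simp [hi]⟩
  · rw [mem_solutions_full_iff] at hx hy
    funext i
    by_cases hi : i ∈ S
    · rw [hx i hi, hy i hi]
    · exact h i hi

theorem eRk_block {S : Finset (Fin r)} (hS : S.Nonempty) (θ : Fin r → G) :
    (dowlingMatroid r G).eRk (block S θ) = (S.card - 1 : ℕ) := by
  classical
  obtain ⟨s, hs⟩ := hS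
  -- The label at `s` determines all labels on `S`, so `S.erase s` serves as the set of dependent
  -- indices.
  rw [← Finset.card_erase_of_mem hs]
  refine le_antisymm (eRk_le_card _ fun f => ?_) (card_le_eRk _ fun x hx y hy h => ?_)
  · refine ⟨fun i => if i ∈ S then f s * ((θ s)⁻¹ : G) * θ i else f i,
      mem_solutions_block_iff.2 fun i hi j hj => ?_, fun i hi => ?_⟩
    · simp only [hi, hj, if_true, mul_assoc, ← WithZero.coe_mul, mul_inv_cancel]
    · by_cases hiS : i ∈ S
      · obtain rfl : i = s := by
          by_contra his
          exact hi (Finset.mem_erase.2 ⟨his, hiS⟩)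
        simp only [hiS, if_true, mul_assoc, ← WithZero.coe_mul, inv_mul_cancel]
        simp
      · simp [hiS]
  · rw [mem_solutions_block_iff] at hx hy
    funext i
    by_cases hi : i ∈ S
    · have hxs := hx i hi s hs
      rw [h s (Finset.notMem_erase s S), ← hy i hi s hs] at hxs
      exact mul_right_cancel₀ WithZero.coe_ne_zero hxs
    · exact h i fun hi' => hi (Finset.mem_of_mem_erase hi')

/-- The elements of a block correspond to the pairs of indices. -/
def blockEquiv (S : Finset (Fin r)) (θ : Fin r → G) : block S θ ≃ ltPairs S where
  toFun
    | ⟨joint _, h⟩ => h.elim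
    | ⟨edge i j hij _, h⟩ => ⟨(i, j), by simp [ltPairs, h.1, h.2.1, hij]⟩
  invFun p := ⟨edge p.1.1 p.1.2 (Finset.mem_filter.1 p.2).2 ((θ p.1.1)⁻¹ * θ p.1.2),
    (Finset.mem_product.1 (Finset.mem_filter.1 p.2).1).1,
    (Finset.mem_product.1 (Finset.mem_filter.1 p.2).1).2, by group⟩
  left_inv := by
    rintro ⟨i | ⟨i, j, hij, a⟩, h⟩
    · exact h.elim
    · simp [← h.2.2]
  right_inv := fun p => rfl

theorem encard_block (S : Finset (Fin r)) (θ : Fin r → G) :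
    (block S θ).encard = (ltPairs S).card := by
  rw [← (Set.toFinite _).cast_ncard_eq, ← Nat.card_coe_set_eq, Nat.card_congr (blockEquiv S θ)]
  simp

end Dowling

/-! ## Classification of the cyclic flats of rank at most three -/

namespace Dowling

open DowlingElement

universe u

variable {r : ℕ} {G : Type u} [Group G]

/-- The element `a_{ij}`, for `i` and `j` in either order, is a consequence of `A`. -/
def Spans (A : Set (DowlingElement r G)) (i j : Fin r) (a : G) : Prop :=
  ∀ x ∈ solutions A, x i * (a : WithZero G) = x j

theorem Spans.symm {A : Set (DowlingElement r G)} {i j : Fin r} {a : G} (h : Spans A i j a) :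
    Spans A j i a⁻¹ := fun x hx => by
  rw [← h x hx, mul_assoc, ← WithZero.coe_mul, mul_inv_cancel, WithZero.coe_one, mul_one]

theorem Spans.trans {A : Set (DowlingElement r G)} {i j k : Fin r} {a b : G}
    (h : Spans A i j a) (h' : Spans A j k b) : Spans A i k (a * b) := fun x hx => by
  rw [WithZero.coe_mul, ← mul_assoc, h x hx, h' x hx]

theorem Spans.refl (A : Set (DowlingElement r G)) (i : Fin r) : Spans A i i 1 := fun x _ => by
  simp

theorem Spans.eq {A : Set (DowlingElement r G)} {i j : Fin r} {a b : G} (h : Spans A i j a)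
    (h' : Spans A i j b) {x : Fin r → WithZero G} (hx : x ∈ solutions A) (hi : x i ≠ 0) :
    a = b :=
  WithZero.coe_injective (mul_left_cancel₀ hi ((h x hx).trans (h' x hx).symm))

theorem Spans.eq_of_eq {A : Set (DowlingElement r G)} {i j : Fin r} {a : G} (h : Spans A i j a)
    {x y : Fin r → WithZero G} (hx : x ∈ solutions A) (hy : y ∈ solutions A)
    (hi : x i = y i) : x j = y j := by
  rw [← h x hx, ← h y hy, hi]

theorem Spans.eq_zero_iff {A : Set (DowlingElement r G)} {i j : Fin r} {a : G}
    (h : Spans A i j a) {x : Fin r → WithZero G} (hx : x ∈ solutions A) : x i = 0 ↔ x j = 0 := by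
  rw [← h x hx, mul_coe_eq_zero_iff]

variable [Finite G] {X : Set (DowlingElement r G)}

theorem joint_mem_iff (hX : (dowlingMatroid r G).IsFlat X) {i : Fin r} :
    joint i ∈ X ↔ ∀ x ∈ solutions X, x i = 0 :=
  ⟨fun h _ hx => hx.1 i h, fun h => isFlat_iff.1 hX _ h⟩

theorem edge_mem_iff (hX : (dowlingMatroid r G).IsFlat X) {i j : Fin r} {hij : i < j} {a : G} :
    edge i j hij a ∈ X ↔ Spans X i j a :=
  ⟨fun h _ hx => hx.2 i j hij a h, fun h => isFlat_iff.1 hX _ h⟩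

theorem Spans.joint_mem_iff (hX : (dowlingMatroid r G).IsFlat X) {i j : Fin r} {a : G}
    (h : Spans X i j a) : joint i ∈ X ↔ joint j ∈ X := by
  rw [Dowling.joint_mem_iff hX, Dowling.joint_mem_iff hX]
  exact forall₂_congr fun x hx => h.eq_zero_iff hx

open Classical in
-- Edges of a flat propagate joints. If `p_i` were the only joint, no edge of `X` would meet `i`,
-- and the indicator of `i` would violate `p_i` alone.
theorem exists_joint_mem_ne (hX : (dowlingMatroid r G).IsFlat X)
    (hc : (dowlingMatroid r G).IsCyclicSet X) {i : Fin r} (hi : joint i ∈ X) :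
    ∃ j, j ≠ i ∧ joint j ∈ X := by
  by_contra! hcon
  have hy : (Pi.single i 1 : Fin r → WithZero G) ∈ solutions (X \ {joint i}) := by
    refine ⟨fun j hj => ?_, fun j k hjk a ha => ?_⟩
    · exact Pi.single_eq_of_ne (fun h => hj.2 (by rw [h]; rfl)) _
    · have hs := ((edge_mem_iff hX).1 ha.1).joint_mem_iff hX
      have hj : j ≠ i := fun h => hcon k (fun hk => hjk.ne (h.trans hk.symm))
        (hs.1 (by rwa [h]))
      have hk : k ≠ i := fun h => hcon j hj (hs.2 (by rwa [h]))
      simp [hj, hk]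
  have h : (Pi.single i 1 : Fin r → WithZero G) i = 0 := isCyclicSet_iff.1 hc _ hi _ hy
  simp at h

open Classical in
-- Otherwise the edge is the only element of `X` at `i`, and setting a nonzero label at `i` to zero
-- violates that edge alone.
theorem exists_third (hX : (dowlingMatroid r G).IsFlat X)
    (hc : (dowlingMatroid r G).IsCyclicSet X) {i j : Fin r} {hij : i < j} {a : G}
    (he : edge i j hij a ∈ X) (hi : joint i ∉ X) :
    ∃ k, k ≠ i ∧ k ≠ j ∧ ∃ b, Spans X i k b := by
  by_contra! hcon
  have ha := (edge_mem_iff hX).1 he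
  rw [joint_mem_iff hX] at hi
  push Not at hi
  obtain ⟨x, hx, hxi⟩ := hi
  have hy : Function.update x i 0 ∈ solutions (X \ {edge i j hij a}) := by
    refine ⟨fun k hk => ?_, fun k l hkl b hb => ?_⟩
    · by_cases hki : k = i
      · rw [hki, Function.update_self]
      · rw [Function.update_of_ne hki, hx.1 k hk.1]
    · have hs := (edge_mem_iff hX).1 hb.1
      have hki : k ≠ i := by
        rintro rfl
        by_cases hlj : l = j
        · subst hlj
          obtain rfl := hs.eq ha hx hxi
          exact hb.2 rfl
        · exact hcon l hkl.ne' hlj b hs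
      have hli : l ≠ i := by
        rintro rfl
        exact hcon k hki (hkl.trans hij).ne _ hs.symm
      rw [Function.update_of_ne hki, Function.update_of_ne hli, hx.2 k l hkl b hb.1]
  have h : Function.update x i 0 i * (a : WithZero G) = Function.update x i 0 j :=
    isCyclicSet_iff.1 hc _ he _ hy
  rw [Function.update_self, zero_mul, Function.update_of_ne hij.ne'] at h
  exact hxi ((ha.eq_zero_iff hx).2 h.symm)

theorem block_subset_of_spans (hX : (dowlingMatroid r G).IsFlat X) {S : Finset (Fin r)}
    {θ : Fin r → G} {s : Fin r} (h : ∀ i ∈ S, Spans X s i (θ i)) : block S θ ⊆ X := by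
  rintro (i | ⟨i, j, hij, a⟩) he
  · exact he.elim
  · rw [edge_mem_iff hX]
    have hs := (h i he.1).symm.trans (h j he.2.1)
    rwa [← he.2.2, inv_mul_cancel_left] at hs

theorem not_four_le {X : Set (DowlingElement r G)} (hrk : (dowlingMatroid r G).eRk X ≤ 3)
    {D : Finset (Fin r)} (hD : D.card = 4) :
    ¬ ∀ x ∈ solutions X, ∀ y ∈ solutions X, (∀ i ∉ D, x i = y i) → x = y := by
  intro h
  have h1 := (card_le_eRk D h).trans hrk
  rw [hD] at h1
  exact absurd h1 (by norm_cast)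

open Classical in
-- Besides two joints `p` and `q`, an edge off the joints would bring a third index `k`. The labels
-- at `p, q` vanish and those at `j, k` follow from `i`, so the rank would be at least four.
theorem eq_full_of_joint_mem (hX : (dowlingMatroid r G).IsFlat X)
    (hc : (dowlingMatroid r G).IsCyclicSet X) (hrk : (dowlingMatroid r G).eRk X ≤ 3) {p : Fin r}
    (hp : joint p ∈ X) : ∃ S : Finset (Fin r), X = full G S := by
  obtain ⟨q, hqp, hq⟩ := exists_joint_mem_ne hX hc hp
  refine ⟨Finset.univ.filter fun i => joint i ∈ X, Set.Subset.antisymm ?_ ?_⟩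
  · rintro (i | ⟨i, j, hij, a⟩) he
    · simpa [joint_mem_full] using he
    · have ha := (edge_mem_iff hX).1 he
      by_cases hi : joint i ∈ X
      · exact ⟨by simpa using hi, by simpa using (ha.joint_mem_iff hX).1 hi⟩
      · exfalso
        obtain ⟨k, hki, hkj, b, hb⟩ := exists_third hX hc he hi
        have hj := (ha.joint_mem_iff hX).not.1 hi
        have hk := (hb.joint_mem_iff hX).not.1 hi
        have hne : ∀ {m n : Fin r}, joint m ∈ X → joint n ∉ X → m ≠ n := by
          rintro m _ hm hn rfl
          exact hn hm
        have hD : ({p, q, j, k} : Finset (Fin r)).card = 4 := by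
          simp [hqp.symm, hkj.symm, hne hp hj, hne hp hk, hne hq hj, hne hq hk]
        refine not_four_le hrk hD fun x hx y hy h => ?_
        have hxy : x i = y i := h i (by
          simp [(hne hp hi).symm, (hne hq hi).symm, hij.ne, hki.symm])
        funext m
        by_cases hm : m ∈ ({p, q, j, k} : Finset (Fin r))
        · simp only [Finset.mem_insert, Finset.mem_singleton] at hm
          rcases hm with rfl | rfl | rfl | rfl
          · rw [hx.1 _ hp, hy.1 _ hp]
          · rw [hx.1 _ hq, hy.1 _ hq]
          · exact ha.eq_of_eq hx hy hxy
          · exact hb.eq_of_eq hx hy hxy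
        · exact h m hm
  · rintro (i | ⟨i, j, hij, a⟩) he
    · simpa [joint_mem_full] using he
    · simp only [edge_mem_full, Finset.mem_filter, Finset.mem_univ, true_and] at he
      rw [edge_mem_iff hX]
      intro x hx
      rw [hx.1 i he.1, hx.1 j he.2, zero_mul]

open Classical in
-- The indices tied to `i` form a block. An edge of `X` outside it would have a third index as well;
-- then `i` determines `j, k` and `m` determines `n, l`, so the rank would be at least four.
theorem eq_block_of_joint_notMem (hX : (dowlingMatroid r G).IsFlat X)
    (hc : (dowlingMatroid r G).IsCyclicSet X) (hrk : (dowlingMatroid r G).eRk X ≤ 3)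
    (hne : X.Nonempty) (hX0 : ∀ i, joint i ∉ X) :
    ∃ (S : Finset (Fin r)) (θ : Fin r → G), 3 ≤ S.card ∧ X = block S θ := by
  obtain ⟨i | ⟨i, j, hij, a⟩, he⟩ := hne
  · exact absurd he (hX0 i)
  have ha := (edge_mem_iff hX).1 he
  obtain ⟨k, hki, hkj, b, hb⟩ := exists_third hX hc he (hX0 i)
  have hθ : ∃ θ : Fin r → G, ∀ m, (∃ c, Spans X i m c) → Spans X i m (θ m) :=
    ⟨fun m => if h : ∃ c, Spans X i m c then h.choose else 1, fun m h => by
      simp only [h, dite_true]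
      exact h.choose_spec⟩
  obtain ⟨θ, hθ⟩ := hθ
  have hiC : ∃ c, Spans X i i c := ⟨1, Spans.refl X i⟩
  refine ⟨Finset.univ.filter fun m => ∃ c, Spans X i m c, θ, ?_, Set.Subset.antisymm ?_ ?_⟩
  · have hsub : ({i, j, k} : Finset (Fin r)) ⊆
        Finset.univ.filter fun m => ∃ c, Spans X i m c := by
      intro m hm
      simp only [Finset.mem_insert, Finset.mem_singleton] at hm
      rw [Finset.mem_filter]
      rcases hm with rfl | rfl | rfl
      exacts [⟨Finset.mem_univ _, hiC⟩, ⟨Finset.mem_univ _, a, ha⟩, ⟨Finset.mem_univ _, b, hb⟩]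
    have h3 : ({i, j, k} : Finset (Fin r)).card = 3 :=
      Finset.card_eq_three.2 ⟨i, j, k, hij.ne, hki.symm, hkj.symm, rfl⟩
    exact h3 ▸ Finset.card_le_card hsub
  · rintro (m | ⟨m, n, hmn, c⟩) hf
    · exact absurd hf (hX0 m)
    have hcs := (edge_mem_iff hX).1 hf
    by_cases hm : ∃ c, Spans X i m c
    · have hn : ∃ c, Spans X i n c := ⟨_, (hθ m hm).trans hcs⟩
      obtain ⟨x, hx, hxi⟩ : ∃ x ∈ solutions X, x i ≠ 0 := by
        have := hX0 i
        rw [joint_mem_iff hX] at this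
        push Not at this
        exact this
      refine ⟨by simpa using hm, by simpa using hn, ?_⟩
      exact ((hθ m hm).trans hcs).eq (hθ n hn) hx hxi
    · exfalso
      obtain ⟨l, hlm, hln, d, hd⟩ := exists_third hX hc hf (hX0 m)
      have hn : ¬ ∃ c, Spans X i n c := fun ⟨t, ht⟩ => hm ⟨_, ht.trans hcs.symm⟩
      have hl : ¬ ∃ c, Spans X i l c := fun ⟨t, ht⟩ => hm ⟨_, ht.trans hd.symm⟩
      have hdist : ∀ {s t : Fin r}, (∃ c, Spans X i s c) → (¬ ∃ c, Spans X i t c) → s ≠ t := by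
        rintro s _ hs ht rfl
        exact ht hs
      have hjC : ∃ c, Spans X i j c := ⟨a, ha⟩
      have hkC : ∃ c, Spans X i k c := ⟨b, hb⟩
      have hD : ({j, k, n, l} : Finset (Fin r)).card = 4 := by
        simp [hkj.symm, hln.symm, hdist hjC hn, hdist hjC hl, hdist hkC hn, hdist hkC hl]
      refine not_four_le hrk hD fun x hx y hy h => ?_
      have hxi : x i = y i := h i (by
        simp [hij.ne, hki.symm, hdist hiC hn, hdist hiC hl])
      have hxm : x m = y m := h m (by
        simp [hmn.ne, hlm.symm, (hdist hjC hm).symm, (hdist hkC hm).symm])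
      funext t
      by_cases ht : t ∈ ({j, k, n, l} : Finset (Fin r))
      · simp only [Finset.mem_insert, Finset.mem_singleton] at ht
        rcases ht with rfl | rfl | rfl | rfl
        exacts [ha.eq_of_eq hx hy hxi, hb.eq_of_eq hx hy hxi, hcs.eq_of_eq hx hy hxm,
          hd.eq_of_eq hx hy hxm]
      · exact h t ht
  · exact block_subset_of_spans hX (s := i) fun m hm => hθ m (by simpa using hm)

/-- A nonempty cyclic flat of rank at most three is a full set or a block. -/
theorem eq_full_or_eq_block (hX : (dowlingMatroid r G).IsFlat X)
    (hc : (dowlingMatroid r G).IsCyclicSet X) {n : ℕ} (hrk : (dowlingMatroid r G).eRk X = n)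
    (h0 : n ≠ 0) (hn : n ≤ 3) :
    (∃ S : Finset (Fin r), S.card = n ∧ X = full G S) ∨
      ∃ (S : Finset (Fin r)) (θ : Fin r → G), S.card = n + 1 ∧ X = block S θ := by
  have hrk' : (dowlingMatroid r G).eRk X ≤ 3 := by
    rw [hrk]
    exact_mod_cast hn
  by_cases hp : ∃ p, joint p ∈ X
  · obtain ⟨p, hp⟩ := hp
    obtain ⟨S, rfl⟩ := eq_full_of_joint_mem hX hc hrk' hp
    rw [eRk_full, Nat.cast_inj] at hrk
    exact Or.inl ⟨S, hrk, rfl⟩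
  · push Not at hp
    have hne : X.Nonempty := by
      rw [Set.nonempty_iff_ne_empty]
      rintro rfl
      rw [Matroid.eRk_empty] at hrk
      exact h0 (by exact_mod_cast hrk.symm)
    obtain ⟨S, θ, hS, rfl⟩ := eq_block_of_joint_notMem hX hc hrk' hne hp
    rw [eRk_block (Finset.card_pos.1 (by omega)), Nat.cast_inj] at hrk
    exact Or.inr ⟨S, θ, by omega, rfl⟩

end Dowling

/-! ## Recovering the group from the configuration -/

namespace Dowling

open DowlingElement

universe u v

/-! ### A group isotopism from potentials on four indices -/

section Potentials

variable {G : Type u} {H : Type v} [Group G] [Group H]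

/-- The potentials `θ` and `η` have the same gains on the indices other than `m`. -/
def AgreeOff {ι : Type*} (m : ι) (θ η : ι → G) : Prop :=
  ∀ p q, p ≠ m → q ≠ m → (θ p)⁻¹ * θ q = (η p)⁻¹ * η q

/-- Potentials with equal gain on the edge `p, q` are linked through one that agrees with `θ` off
`m` and with `η` off `n`; both triangles contain that edge. -/
theorem ratio_eq_of_agreeOff_imp {ι : Type*} [DecidableEq ι] {Ψ : (ι → G) → (ι → H)}
    (hΨ : ∀ m θ η, AgreeOff m θ η → AgreeOff m (Ψ θ) (Ψ η)) {p q m n : ι}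
    (hpm : p ≠ m) (hqm : q ≠ m) (hpn : p ≠ n) (hqn : q ≠ n)
    (hcover : ∀ k, k = p ∨ k = q ∨ k = m ∨ k = n) {θ η : ι → G}
    (h : (θ p)⁻¹ * θ q = (η p)⁻¹ * η q) :
    (Ψ θ p)⁻¹ * Ψ θ q = (Ψ η p)⁻¹ * Ψ η q := by
  -- Off `n` this is the left translate of `η` by `θ p * (η p)⁻¹`, which has the same gains as `η`.
  let ζ : ι → G := fun k => if k = m then θ p * (η p)⁻¹ * η m else θ k
  have hζθ : AgreeOff m ζ θ := fun a b ha hb => by simp [ζ, ha, hb]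
  have hζη : ∀ a, a ≠ n → ζ a = θ p * (η p)⁻¹ * η a := by
    intro a ha
    by_cases ham : a = m
    · simp [ζ, ham]
    · simp only [ζ, ham, if_false]
      rcases hcover a with rfl | rfl | h' | h'
      · simp
      · rw [mul_assoc, ← h, mul_inv_cancel_left]
      · exact absurd h' ham
      · exact absurd h' ha
  have hζη' : AgreeOff n ζ η := fun a b ha hb => by
    rw [hζη a ha, hζη b hb]
    group
  rw [← hΨ m ζ θ hζθ p q hpm hqm, hΨ n ζ η hζη' p q hpn hqn]

/-- A map between potentials on four indices that preserves and reflects agreement off every index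
induces an isotopism of the groups, and hence an embedding. -/
theorem exists_injective_hom {Ψ : (Fin 4 → G) → (Fin 4 → H)}
    (hΨ : ∀ m θ η, AgreeOff m θ η ↔ AgreeOff m (Ψ θ) (Ψ η)) :
    ∃ f : G →* H, Function.Injective f := by
  have h01 : ∀ {θ η : Fin 4 → G}, (θ 0)⁻¹ * θ 1 = (η 0)⁻¹ * η 1 →
      (Ψ θ 0)⁻¹ * Ψ θ 1 = (Ψ η 0)⁻¹ * Ψ η 1 := fun h =>
    ratio_eq_of_agreeOff_imp (fun m θ η => (hΨ m θ η).1) (m := 2) (n := 3) (by decide)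
      (by decide) (by decide) (by decide) (by decide) h
  have h12 : ∀ {θ η : Fin 4 → G}, (θ 1)⁻¹ * θ 2 = (η 1)⁻¹ * η 2 →
      (Ψ θ 1)⁻¹ * Ψ θ 2 = (Ψ η 1)⁻¹ * Ψ η 2 := fun h =>
    ratio_eq_of_agreeOff_imp (fun m θ η => (hΨ m θ η).1) (m := 0) (n := 3) (by decide)
      (by decide) (by decide) (by decide) (by decide) h
  have h02 : ∀ {θ η : Fin 4 → G}, (θ 0)⁻¹ * θ 2 = (η 0)⁻¹ * η 2 →
      (Ψ θ 0)⁻¹ * Ψ θ 2 = (Ψ η 0)⁻¹ * Ψ η 2 := fun h =>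
    ratio_eq_of_agreeOff_imp (fun m θ η => (hΨ m θ η).1) (m := 1) (n := 3) (by decide)
      (by decide) (by decide) (by decide) (by decide) h
  let α : G → H := fun a => (Ψ ![1, a, 1, 1] 0)⁻¹ * Ψ ![1, a, 1, 1] 1
  let β : G → H := fun b => (Ψ ![1, 1, b, 1] 1)⁻¹ * Ψ ![1, 1, b, 1] 2
  let γ : G → H := fun c => (Ψ ![1, 1, c, 1] 0)⁻¹ * Ψ ![1, 1, c, 1] 2
  have hα : ∀ θ : Fin 4 → G, (Ψ θ 0)⁻¹ * Ψ θ 1 = α ((θ 0)⁻¹ * θ 1) := fun θ => h01 (by simp)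
  have hβ : ∀ θ : Fin 4 → G, (Ψ θ 1)⁻¹ * Ψ θ 2 = β ((θ 1)⁻¹ * θ 2) := fun θ => h12 (by simp)
  have hγ : ∀ θ : Fin 4 → G, (Ψ θ 0)⁻¹ * Ψ θ 2 = γ ((θ 0)⁻¹ * θ 2) := fun θ => h02 (by simp)
  have hmul : ∀ a b, γ (a * b) = α a * β b := by
    intro a b
    -- This potential has gains `a`, `b` and `a * b` on the triangle `0, 1, 2`.
    have h1 := hα ![1, a, a * b, 1]
    have h2 := hβ ![1, a, a * b, 1]
    have h3 := hγ ![1, a, a * b, 1]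
    simp only [Matrix.cons_val, inv_one, one_mul, inv_mul_cancel_left] at h1 h2 h3
    rw [← h1, ← h2, ← h3]
    group
  have hinj : Function.Injective γ := by
    intro a b hab
    have hβab : β a = β b := by
      have h1 := hmul 1 a
      rw [one_mul, hab, ← one_mul b, hmul] at h1
      exact (mul_left_cancel h1).symm
    -- Injectivity comes from reflection: the two images agree on the triangle `0, 1, 2`, hence so
    -- do the potentials.
    have hag : AgreeOff 3 (Ψ ![1, 1, a, 1]) (Ψ ![1, 1, b, 1]) := by
      have h1 : (Ψ ![1, 1, a, 1] 0)⁻¹ * Ψ ![1, 1, a, 1] 1 =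
          (Ψ ![1, 1, b, 1] 0)⁻¹ * Ψ ![1, 1, b, 1] 1 := h01 (by simp)
      have key : ∀ p, p ≠ 3 → (Ψ ![1, 1, a, 1] 0)⁻¹ * Ψ ![1, 1, a, 1] p =
          (Ψ ![1, 1, b, 1] 0)⁻¹ * Ψ ![1, 1, b, 1] p := by
        intro p hp
        fin_cases p
        · simp
        · exact h1
        · exact hab
        · exact absurd rfl hp
      intro p q hp hq
      have hp' := key p hp
      have hq' := key q hq
      rw [inv_mul_eq_iff_eq_mul] at hp' hq'
      rw [hp', hq']
      group
    have h3 := (hΨ 3 _ _).2 hag 0 2 (by decide) (by decide)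
    simpa using h3
  -- Dividing by `γ 1 = α 1 * β 1` normalises the isotopism to a homomorphism.
  refine ⟨MonoidHom.mk' (fun a => γ a * (γ 1)⁻¹) fun a b => ?_, fun a b hab => ?_⟩
  · have h1 := hmul a 1
    have h2 := hmul 1 b
    have h3 := hmul 1 1
    rw [mul_one] at h1 h3
    rw [one_mul] at h2
    rw [hmul a b, h1, h2, h3]
    group
  · exact hinj (mul_right_cancel (b := (γ 1)⁻¹) hab)

end Potentials

/-! ### The action of a configuration isomorphism on blocks and full flats -/

variable {r : ℕ} {G : Type u} {H : Type v} [Group G] [Group H] [Finite G] [Finite H]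

/-- A block with at least three indices as a cyclic flat. -/
def blockFlat (S : Finset (Fin r)) (hS : 3 ≤ S.card) (θ : Fin r → G) :
    (dowlingMatroid r G).CyclicFlat :=
  ⟨block S θ, isFlat_block S θ, isCyclicSet_block hS θ⟩

variable (G) in
/-- A full set with at least two indices as a cyclic flat. -/
def fullFlat (S : Finset (Fin r)) (hS : 2 ≤ S.card) : (dowlingMatroid r G).CyclicFlat :=
  ⟨full G S, isFlat_full S, isCyclicSet_full hS⟩

theorem coe_blockFlat {S : Finset (Fin r)} {hS : 3 ≤ S.card} {θ : Fin r → G} :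
    (blockFlat S hS θ : Set (DowlingElement r G)) = block S θ := rfl

theorem coe_fullFlat {S : Finset (Fin r)} {hS : 2 ≤ S.card} :
    (fullFlat G S hS : Set (DowlingElement r G)) = full G S := rfl

/-- The order isomorphism `φ` preserves the size and the rank of each cyclic flat. -/
def PreservesConfiguration
    (φ : (dowlingMatroid r G).CyclicFlat ≃o (dowlingMatroid r H).CyclicFlat) : Prop :=
  ∀ X, (φ X : Set (DowlingElement r H)).encard = (X : Set (DowlingElement r G)).encard ∧
    (dowlingMatroid r H).eRk (φ X) = (dowlingMatroid r G).eRk X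

variable {φ : (dowlingMatroid r G).CyclicFlat ≃o (dowlingMatroid r H).CyclicFlat}

theorem PreservesConfiguration.symm (hφ : PreservesConfiguration φ) :
    PreservesConfiguration φ.symm := fun X => by
  obtain ⟨h1, h2⟩ := hφ (φ.symm X)
  rw [φ.apply_symm_apply] at h1 h2
  exact ⟨h1.symm, h2.symm⟩

/-- In rank three a full flat has `3 + 3|G|` elements and a block has `6`, which coincide only for
the trivial group. -/
theorem PreservesConfiguration.exists_full (hφ : PreservesConfiguration φ)
    (hG : Nat.card G ≠ 1) {T : Finset (Fin r)} (hT : T.card = 3) :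
    Nat.card G = Nat.card H ∧
      ∃ T' : Finset (Fin r), T'.card = 3 ∧
        (φ (fullFlat G T (by omega)) : Set (DowlingElement r H)) = full H T' := by
  obtain ⟨hcard, hrk⟩ := hφ (fullFlat G T (by omega))
  replace hrk : (dowlingMatroid r H).eRk (φ (fullFlat G T (by omega))) = (3 : ℕ) := by
    rw [hrk, coe_fullFlat, eRk_full, hT]
  have hlt := card_ltPairs T
  rw [hT] at hlt
  rcases eq_full_or_eq_block (φ (fullFlat G T _)).2.1 (φ (fullFlat G T _)).2.2 hrk
    (by norm_num) le_rfl with ⟨S, hS, hSX⟩ | ⟨S, θ, hS, hSX⟩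
  · refine ⟨?_, S, hS, hSX⟩
    have hlt' := card_ltPairs S
    rw [hS] at hlt'
    rw [hSX, coe_fullFlat, encard_full, encard_full, Nat.cast_inj, hS, hT,
      show (ltPairs S).card = 3 by omega, show (ltPairs T).card = 3 by omega] at hcard
    omega
  · have hlt' := card_ltPairs S
    rw [hS] at hlt'
    rw [hSX, coe_fullFlat, encard_full, encard_block, Nat.cast_inj, hT,
      show (ltPairs S).card = 6 by omega, show (ltPairs T).card = 3 by omega] at hcard
    omega

/-- In ranks two and three, blocks have `3` and `6` elements, full flats `2 + |H|` and `3 + 3|H|`.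
-/
theorem PreservesConfiguration.exists_block (hφ : PreservesConfiguration φ)
    (hH : Nat.card H ≠ 1) {S : Finset (Fin r)} (hS : 3 ≤ S.card) (hS' : S.card ≤ 4)
    (θ : Fin r → G) :
    ∃ (S' : Finset (Fin r)) (θ' : Fin r → H), S'.card = S.card ∧
      (φ (blockFlat S hS θ) : Set (DowlingElement r H)) = block S' θ' := by
  obtain ⟨hcard, hrk⟩ := hφ (blockFlat S hS θ)
  rw [coe_blockFlat, eRk_block (Finset.card_pos.1 (by omega))] at hrk
  rcases eq_full_or_eq_block (φ (blockFlat S hS θ)).2.1 (φ (blockFlat S hS θ)).2.2 hrk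
    (by omega) (by omega) with ⟨T, hT, hTX⟩ | ⟨T, θ', hT, hTX⟩
  · exfalso
    have hlt := card_ltPairs S
    have hlt' := card_ltPairs T
    rw [hTX, coe_blockFlat, encard_full, encard_block, Nat.cast_inj] at hcard
    have hpos : 0 < Nat.card H := Nat.card_pos
    obtain h | h : S.card = 3 ∨ S.card = 4 := by omega
    · rw [h] at hlt hT
      rw [hT] at hlt' hcard
      rw [show (ltPairs S).card = 3 by omega, show (ltPairs T).card = 1 by omega] at hcard
      omega
    · rw [h] at hlt hT
      rw [hT] at hlt' hcard
      rw [show (ltPairs S).card = 6 by omega, show (ltPairs T).card = 3 by omega] at hcard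
      omega
  · exact ⟨T, θ', by omega, hTX⟩

theorem PreservesConfiguration.exists_injective_hom (hφ : PreservesConfiguration φ) (hr : 4 ≤ r)
    (hG : Nat.card G ≠ 1) (hH : Nat.card H ≠ 1) : ∃ f : G →* H, Function.Injective f := by
  classical
  let v : Fin 4 → Fin r := Fin.castLE hr
  have hv : Function.Injective v := Fin.castLE_injective hr
  let S : Finset (Fin r) := Finset.univ.image v
  have hS : S.card = 4 := by rw [Finset.card_image_of_injective _ hv]; simp
  have hvS : ∀ m, v m ∈ S := fun m => Finset.mem_image_of_mem v (Finset.mem_univ m)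
  have hT : ∀ m, (S.erase (v m)).card = 3 := fun m => by
    rw [Finset.card_erase_of_mem (hvS m), hS]
  have hmemT : ∀ m i, i ∈ S.erase (v m) ↔ ∃ p, p ≠ m ∧ v p = i := by
    intro m i
    simp only [S, Finset.mem_erase, Finset.mem_image, Finset.mem_univ, true_and]
    constructor
    · rintro ⟨h, p, rfl⟩
      exact ⟨p, fun hp => h (hp ▸ rfl), rfl⟩
    · rintro ⟨p, hp, rfl⟩
      exact ⟨hv.ne hp, p, rfl⟩
  choose T' hT' hφT using fun m => (hφ.exists_full hG (hT m)).2
  have hT'inj : Function.Injective T' := by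
    intro m n hmn
    have h1 : φ (fullFlat G (S.erase (v m)) (by rw [hT]; omega)) =
        φ (fullFlat G (S.erase (v n)) (by rw [hT]; omega)) :=
      Subtype.ext (by rw [hφT, hφT, hmn])
    have h2 : full G (S.erase (v m)) = full G (S.erase (v n)) :=
      congrArg Subtype.val (φ.injective h1)
    have h3 : S.erase (v m) = S.erase (v n) :=
      (full_subset_full_iff.1 h2.subset).antisymm (full_subset_full_iff.1 h2.superset)
    by_contra hne
    have h4 : v m ∈ S.erase (v n) := (hmemT n _).2 ⟨m, hne, rfl⟩
    rw [← h3] at h4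
    exact Finset.notMem_erase _ _ h4
  choose B Ψ hB hφB using fun θ : Fin r → G => hφ.exists_block hH (S := S) (by omega) (by omega) θ
  -- The image of a triangle lies in `full H (T' m)`, which fixes its indices, and in `block (B θ)
  -- (Ψ θ)`, which fixes its gains.
  have htri : ∀ m θ, T' m ⊆ B θ ∧
      (φ (blockFlat (S.erase (v m)) (hT m).ge θ) : Set (DowlingElement r H)) =
        block (T' m) (Ψ θ) := by
    intro m θ
    obtain ⟨T, η, hTc, hTη⟩ := hφ.exists_block hH (hT m).ge (by rw [hT]; omega) θ
    rw [hT] at hTc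
    have h1 : block T η ⊆ full H (T' m) := by
      rw [← hTη, ← hφT]
      exact φ.monotone (a := blockFlat (S.erase (v m)) (hT m).ge θ)
        (b := fullFlat G (S.erase (v m)) (by rw [hT]; omega)) (block_subset_full _ θ)
    have h2 : block T η ⊆ block (B θ) (Ψ θ) := by
      rw [← hTη, ← hφB]
      exact φ.monotone (a := blockFlat (S.erase (v m)) (hT m).ge θ)
        (b := blockFlat S (by omega) θ)
        (block_subset_block (Finset.erase_subset _ _) fun _ _ _ _ => rfl)
    obtain rfl : T = T' m := Finset.eq_of_subset_of_card_le
      (subset_of_block_subset (by omega) h1) (by rw [hTc, hT'])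
    refine ⟨subset_of_block_subset (by omega) (h2.trans (block_subset_full _ _)), ?_⟩
    rw [hTη, block_eq_block_iff]
    exact fun i hi j hj => ratio_eq_of_block_subset h2 hi hj
  -- Each `T' m` omits one index `w m` of `B 1`, so `w` labels the four target indices; the constant
  -- potential `1` is an arbitrary choice.
  have hwex : ∀ m, ∃ w ∈ B 1, T' m = (B 1).erase w := by
    intro m
    have hsub := (htri m 1).1
    obtain ⟨w, hw⟩ := Finset.card_eq_one.1
      (show (B 1 \ T' m).card = 1 by rw [Finset.card_sdiff_of_subset hsub, hB, hS, hT'])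
    have hwB : w ∈ B 1 \ T' m := hw ▸ Finset.mem_singleton_self w
    refine ⟨w, (Finset.mem_sdiff.1 hwB).1, ?_⟩
    rw [← Finset.sdiff_singleton_eq_erase, ← hw, Finset.sdiff_sdiff_eq_self hsub]
  choose w hwB hw using hwex
  have hwinj : Function.Injective w := fun m n hmn => hT'inj (by rw [hw, hw, hmn])
  have hBw : B 1 = Finset.univ.image w := by
    refine (Finset.eq_of_subset_of_card_le ?_ ?_).symm
    · intro i hi
      obtain ⟨m, -, rfl⟩ := Finset.mem_image.1 hi
      exact hwB m
    · rw [Finset.card_image_of_injective _ hwinj, hB, hS]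
      simp
  have hmemT' : ∀ m i, i ∈ T' m ↔ ∃ p, p ≠ m ∧ w p = i := by
    intro m i
    simp only [hw, hBw, Finset.mem_erase, Finset.mem_image, Finset.mem_univ, true_and]
    constructor
    · rintro ⟨h, p, rfl⟩
      exact ⟨p, fun hp => h (hp ▸ rfl), rfl⟩
    · rintro ⟨p, hp, rfl⟩
      exact ⟨hwinj.ne hp, p, rfl⟩
  have hagree : ∀ m (θ η : Fin r → G),
      AgreeOff m (θ ∘ v) (η ∘ v) ↔ AgreeOff m (Ψ θ ∘ w) (Ψ η ∘ w) := by
    intro m θ η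
    have h1 : block (S.erase (v m)) θ = block (S.erase (v m)) η ↔
        block (T' m) (Ψ θ) = block (T' m) (Ψ η) := by
      rw [← (htri m θ).2, ← (htri m η).2, Subtype.val_inj, φ.injective.eq_iff, Subtype.ext_iff,
        coe_blockFlat, coe_blockFlat]
    rw [block_eq_block_iff, block_eq_block_iff] at h1
    simp only [hmemT, hmemT'] at h1
    constructor
    · intro h p q hp hq
      refine h1.1 ?_ _ ⟨p, hp, rfl⟩ _ ⟨q, hq, rfl⟩
      rintro _ ⟨p, hp, rfl⟩ _ ⟨q, hq, rfl⟩
      exact h p q hp hq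
    · intro h p q hp hq
      refine h1.2 ?_ _ ⟨p, hp, rfl⟩ _ ⟨q, hq, rfl⟩
      rintro _ ⟨p, hp, rfl⟩ _ ⟨q, hq, rfl⟩
      exact h p q hp hq
  -- The value `1` off the four chosen indices is immaterial, since agreement is only tested along
  -- `v`.
  refine Dowling.exists_injective_hom (Ψ := fun θ => Ψ (Function.extend v θ 1) ∘ w)
    fun m θ η => ?_
  rw [← hagree, Function.extend_comp hv, Function.extend_comp hv]

theorem nonempty_mulEquiv_of_sameConfiguration (hr : 4 ≤ r)
    (h : Matroid.SameConfiguration (dowlingMatroid r G) (dowlingMatroid r H)) :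
    Nonempty (G ≃* H) := by
  obtain ⟨φ, hφ⟩ := h
  have hφ : PreservesConfiguration φ := hφ
  obtain ⟨T, hT⟩ : ∃ T : Finset (Fin r), T.card = 3 := by
    obtain ⟨T, -, hT⟩ := Finset.exists_subset_card_eq
      (show 3 ≤ (Finset.univ : Finset (Fin r)).card by simp; omega)
    exact ⟨T, hT⟩
  have hGH : Nat.card G = Nat.card H := by
    -- Sizes do not separate the flats of a trivial group; if only `G` is trivial, the inverse
    -- isomorphism starts from the nontrivial group `H`.
    by_cases hG : Nat.card G = 1
    · by_contra hne
      exact hne (hφ.symm.exists_full (fun hH => hne (hG.trans hH.symm)) hT).1.symm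
    · exact (hφ.exists_full hG hT).1
  by_cases hG : Nat.card G = 1
  · have := (Nat.card_eq_one_iff_unique.1 hG).1
    have := (Nat.card_eq_one_iff_unique.1 (hGH ▸ hG)).1
    exact ⟨⟨⟨fun _ => 1, fun _ => 1, fun _ => Subsingleton.elim _ _,
      fun _ => Subsingleton.elim _ _⟩, fun _ _ => Subsingleton.elim _ _⟩⟩
  · obtain ⟨f, hf⟩ := hφ.exists_injective_hom hr hG (hGH ▸ hG)
    exact ⟨MulEquiv.ofBijective f (hf.bijective_of_nat_card_le hGH.ge)⟩

/-! ## Coloops -/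

theorem coloops_eq_empty (hr : 2 ≤ r) : (dowlingMatroid r G).coloops = ∅ := by
  rw [coloops_eq_empty_iff]
  rintro (i | ⟨i, j, hij, a⟩) x hx
  · have : Nontrivial (Fin r) := Fin.nontrivial_iff_two_le.2 hr
    obtain ⟨j, hji⟩ := exists_ne i
    have h0 : x j = 0 := hx.1 j (by simpa using hji)
    change x i = 0
    rcases lt_or_gt_of_ne hji with hlt | hlt
    · rw [← hx.2 j i hlt 1 (by simp), h0, zero_mul]
    · have h1 := hx.2 i j hlt 1 (by simp)
      rwa [h0, mul_coe_eq_zero_iff] at h1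
  · change x i * (a : WithZero G) = x j
    rw [hx.1 i (by simp), hx.1 j (by simp), zero_mul]

end Dowling

/-! ### Two groups of order four and the conclusion -/

theorem not_nonempty_mulEquiv_zmod_four :
    ¬ Nonempty (Multiplicative (ZMod 4) ≃* Multiplicative (ZMod 2 × ZMod 2)) := by
  rintro ⟨f⟩
  have h : ∀ y : Multiplicative (ZMod 2 × ZMod 2), y * y = 1 := by decide
  have h1 := h (f (Multiplicative.ofAdd 1))
  rw [← map_mul, EmbeddingLike.map_eq_one_iff] at h1
  exact absurd h1 (by decide)

theorem proposition7p4 :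
    -- for `r ≥ 4`, Dowling matroids with the same configuration come from isomorphic groups
    (∀ (r : ℕ), 4 ≤ r → ∀ (G : Type*) (H : Type*) [Group G] [Finite G] [Group H] [Finite H],
      Matroid.SameConfiguration (dowlingMatroid r G) (dowlingMatroid r H) →
        Nonempty (G ≃* H)) ∧
    -- the `G`-invariant of a Dowling matroid depends only on `r` and the order of the group
    (∀ (r : ℕ) (G : Type*) (H : Type*) [Group G] [Finite G] [Group H] [Finite H],
      Nat.card G = Nat.card H →
        (dowlingMatroid r G).gInvariant = (dowlingMatroid r H).gInvariant) ∧
    -- so the `G`-invariant of a matroid with no coloops does not determine its configuration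
    (∀ (r : ℕ), 4 ≤ r →
      ∃ (G : Type) (H : Type) (_ : Group G) (_ : Finite G) (_ : Group H) (_ : Finite H),
        (dowlingMatroid r G).coloops = ∅ ∧ (dowlingMatroid r H).coloops = ∅ ∧
        (dowlingMatroid r G).gInvariant = (dowlingMatroid r H).gInvariant ∧
        ¬ Matroid.SameConfiguration (dowlingMatroid r G) (dowlingMatroid r H)) := by
  refine ⟨fun r hr G H _ _ _ _ h => Dowling.nonempty_mulEquiv_of_sameConfiguration hr h,
    fun r G H _ _ _ _ h => Dowling.gInvariant_eq h, fun r hr => ?_⟩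
  refine ⟨Multiplicative (ZMod 4), Multiplicative (ZMod 2 × ZMod 2), inferInstance, inferInstance,
    inferInstance, inferInstance, Dowling.coloops_eq_empty (by omega),
    Dowling.coloops_eq_empty (by omega), Dowling.gInvariant_eq ?_, fun h => ?_⟩
  · simp [Nat.card_eq_fintype_card]
  · exact not_nonempty_mulEquiv_zmod_four
      (Dowling.nonempty_mulEquiv_of_sameConfiguration hr h)
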